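/- Let $N\ge 3$, let $C_1,C_2,C_3\in\mathbb C^{N\times N}$ be Hermitian, put $c_i(u)=u^HC_iu$, and write $\lambda_{\min}$ for the smallest eigenvalue of a Hermitian matrix. Let $A_1=C_1$, $A_2=C_1-C_2$, $A_3=C_1-C_3$. For a nonempty $I\subseteq\{1,2,3\}$ let $F_I$ be the set of unit vectors $u\in\mathbb C^N$ with $c_i(u)=c_j(u)$ for all $i,j\in I$; a candidate point for $I$ is an element of $F_I$ that minimizes the common value of the $c_i$ ($i\in I$) over $F_I$. An index $i$ is called binding at $u$ if $c_i(u)=\max(c_1(u),c_2(u),c_3(u))$. Then: 1. The minimum $c^\star=\min_{\|u\|=1}\max(c_1(u),c_2(u),c_3(u))$ is attained. For every nonempty $I$ with $F_I\ne\emptyset$ a candidate point exists. However one candidate point $w_I$ is chosen for each such $I$ (at most seven points: one for $I=\{1,2,3\}$, three for pairs, three for singletons), $c^\star$ is the smallest of the numbers $\max(c_1(w_I),c_2(w_I),c_3(w_I))$. 2. (Three binding constraints.) If $z$ is a candidate point for $\{1,2,3\}$, then $$c_1(z)=\sup_{t_1,t_2\in\mathbb R}\lambda_{\min}(A_1+t_1A_2+t_2A_3)=\sup\{\lambda\in\mathbb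 R:\ A_1+t_1A_2+t_2A_3-\lambda I\succeq0\text{ for some }t_1,t_2\in\mathbb R\},$$ and both suprema are maxima if no matrix $sA_2+tA_3$ with $s,t\in\mathbb R$, $(s,t)\ne(0,0)$, is positive semidefinite. If $F_{\{1,2,3\}}=\emptyset$, both suprema are $+\infty$. 3. (Two binding constraints.) For $i\ne j$, if $y$ is a candidate point for $\{i,j\}$, then $$c_i(y)=\sup_{t\in\mathbb R}\lambda_{\min}(C_i+t(C_i-C_j))=\sup\{\lambda\in\mathbb R:\ C_i+t(C_i-C_j)-\lambda I\succeq0\text{ for some }t\in\mathbb R\},$$ and both suprema are maxima if neither $C_i-C_j$ nor $C_j-C_i$ is positive semidefinite. If $F_{\{i,j\}}=\emptyset$, both suprema are $+\infty$. 4. (One binding constraint.) The candidate points for $\{i\}$ are exactly the unit eigenvectors of $C_i$ for the eigenvalue $\lambda_{\min}(C_i)$, and $c_i$ takes the value $\lambda_{\min}(C_i)$ at each of them. 5. Let $u$ be any unit vector with $\max(c_1(u),c_2(u),c_3(u))=c^\star$, and let $I$ be the set of indices binding at $u$. Then $u$ is a candidate point for $I$. If $I=\{1,2,3\}$, then $c^\star=\max_{t_1,t_2}\lambda_{\min}(A_1+t_1A_2+t_2A_3)$;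 if $I=\{i,j\}$ with $i\ne j$, then $c^\star=\max_t\lambda_{\min}(C_i+t(C_i-C_j))$; in both cases the maximum is attained and is also the optimal value, likewise attained, of the corresponding semidefinite program in 2 or 3. If $I=\{i\}$, then $c^\star=\lambda_{\min}(C_i)$. -/

import Mathlib

open scoped ComplexOrder

noncomputable section

/-- The real number `uᴴ A u`; for Hermitian `A` the complex number `uᴴ A u` is real. -/
def quadVal {N : ℕ} (A : Matrix (Fin N) (Fin N) ℂ) (u : EuclideanSpace ℂ (Fin N)) : ℝ :=
  (star u.ofLp ⬝ᵥ A.mulVec u.ofLp).re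

/-- The smallest (real) eigenvalue of a Hermitian matrix. -/
def lambdaMin {N : ℕ} (A : Matrix (Fin N) (Fin N) ℂ) : ℝ :=
  sInf {r : ℝ | Module.End.HasEigenvalue (Matrix.toLin' A) (r : ℂ)}

/-- The unit vectors of `ℂᴺ`. -/
def unitVectors (N : ℕ) : Set (EuclideanSpace ℂ (Fin N)) := {u | ‖u‖ = 1}

/-- The objective `max (c₁(u), c₂(u), c₃(u))`, where `cᵢ(u) = uᴴ Cᵢ u`. -/
def maxCost {N : ℕ} (C : Fin 3 → Matrix (Fin N) (Fin N) ℂ) (u : EuclideanSpace ℂ (Fin N)) : ℝ :=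
  max (quadVal (C 0) u) (max (quadVal (C 1) u) (quadVal (C 2) u))

/-- The constraints that are binding at `u`: those attaining the maximum. -/
def activeSet {N : ℕ} (C : Fin 3 → Matrix (Fin N) (Fin N) ℂ) (u : EuclideanSpace ℂ (Fin N)) :
    Set (Fin 3) :=
  {i | quadVal (C i) u = maxCost C u}

/-- The unit vectors at which all `cᵢ`, `i ∈ I`, coincide. -/
def bindingSet {N : ℕ} (C : Fin 3 → Matrix (Fin N) (Fin N) ℂ) (I : Set (Fin 3)) :
    Set (EuclideanSpace ℂ (Fin N)) :=
  {u | u ∈ unitVectors N ∧ ∀ i ∈ I, ∀ j ∈ I, quadVal (C i) u = quadVal (C j) u}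

/-- `u` minimizes the common value of the `cᵢ`, `i ∈ I`, over the unit vectors at which they
coincide. The seven nonempty sets `I` give the seven candidate points. -/
def IsCandidate {N : ℕ} (C : Fin 3 → Matrix (Fin N) (Fin N) ℂ) (I : Set (Fin 3))
    (u : EuclideanSpace ℂ (Fin N)) : Prop :=
  u ∈ bindingSet C I ∧ ∀ i ∈ I, ∀ v ∈ bindingSet C I, quadVal (C i) u ≤ quadVal (C i) v

/-- The values `λ_min (A₁ + t A₂)`, `t ∈ ℝ`. -/
def eigValuesTwo {N : ℕ} (A₁ A₂ : Matrix (Fin N) (Fin N) ℂ) : Set ℝ :=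
  {l | ∃ t : ℝ, l = lambdaMin (A₁ + t • A₂)}

/-- The objective values `l` of the feasible points `(l, t)` of the semidefinite program
`max l` subject to `A₁ + t A₂ - l I ⪰ 0`. -/
def sdpValuesTwo {N : ℕ} (A₁ A₂ : Matrix (Fin N) (Fin N) ℂ) : Set ℝ :=
  {l | ∃ t : ℝ, (A₁ + t • A₂ - l • (1 : Matrix (Fin N) (Fin N) ℂ)).PosSemidef}

/-- The values `λ_min (A₁ + t₁ A₂ + t₂ A₃)`, `t₁, t₂ ∈ ℝ`. -/
def eigValuesThree {N : ℕ} (A₁ A₂ A₃ : Matrix (Fin N) (Fin N) ℂ) : Set ℝ :=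
  {l | ∃ t₁ t₂ : ℝ, l = lambdaMin (A₁ + t₁ • A₂ + t₂ • A₃)}

/-- The objective values `l` of the feasible points `(l, t₁, t₂)` of the semidefinite program
`max l` subject to `A₁ + t₁ A₂ + t₂ A₃ - l I ⪰ 0`. -/
def sdpValuesThree {N : ℕ} (A₁ A₂ A₃ : Matrix (Fin N) (Fin N) ℂ) : Set ℝ :=
  {l | ∃ t₁ t₂ : ℝ,
    (A₁ + t₁ • A₂ + t₂ • A₃ - l • (1 : Matrix (Fin N) (Fin N) ℂ)).PosSemidef}

end

/-! Everything rests on `convex_jointRange`: for `N ≥ 3` the set of triples `(c₁(u), c₂(u), c₃(u))`,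
`‖u‖ = 1`, is convex, although the unit sphere is not. The nonconvex quadratic problems thereby
become convex problems in `ℝ³`.

Convexity reduces to `exists_common_isotropic`. To reach the point `p` between the values at `x` and
`y`, subtract `pᵢ I` from each matrix and rescale `x`, `y` so that the three forms take opposite
values at them. On the plane they span, the forms are then trace-free, that is, vectors in `ℝ³`. If
these are dependent, the Hopf map gives a common isotropic vector in the plane. If not, a real
change of basis turns them into the Pauli matrices, and a third direction, available because `N ≥
3`, leads to a real system that is solved by the intermediate value theorem
(`exists_real_solution`).

Given convexity, the eigenvalue and semidefinite programs are Lagrangian duals, and Hahn–Banach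
separation gives strong duality. The dual is attained when no nonzero combination of the constraint
matrices is positive semidefinite (`exists_multiplier_of_le`). At a min-max optimum it is attained
unconditionally, since the minimax theorem supplies weights supported on the binding indices
(`exists_multipliers`).

The comparison of candidates moves along segments of the joint range: an optimum is a candidate for
its own binding set, and if that set is maximal, every candidate for it is optimal. -/

/-! ### A real system solved by the intermediate value theorem -/

lemma exists_zero_of_nonpos_of_nonneg {f : ℝ → ℝ} (hf : ContinuousOn f (Set.Ici 0))
    (h0 : f 0 ≤ 0) {S : ℝ} (hS : 0 < S) (h1 : 0 ≤ f S) : ∃ s, 0 ≤ s ∧ f s = 0 := by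
  obtain ⟨s, hs, h⟩ := intermediate_value_Icc hS.le (hf.mono fun x hx => hx.1) ⟨h0, h1⟩
  exact ⟨s, hs.1, h⟩

/-- Both fractions tend to zero as `s` grows, so the leading square dominates. This gives the
positive end for the intermediate value argument. -/
lemma exists_pos_quadratic_of_bounded_perturbation (k a b c d α β m n : ℝ) :
    ∃ s : ℝ, 0 < s ∧ 0 < (s + k) ^ 2 - (α + n / (s + 2 * k)) ^ 2 - (β + m / s) ^ 2
      + a * (s + k) + b * (α + n / (s + 2 * k)) + c * (β + m / s) + d := by
  have hX : Filter.Tendsto (fun s : ℝ => n / (s + 2 * k)) Filter.atTop (nhds 0) :=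
    Filter.Tendsto.const_div_atTop (Filter.tendsto_atTop_add_const_right _ _ Filter.tendsto_id) n
  have hY : Filter.Tendsto (fun s : ℝ => m / s) Filter.atTop (nhds 0) :=
    Filter.Tendsto.const_div_atTop Filter.tendsto_id m
  have hr : Filter.Tendsto (fun s : ℝ => s + k) Filter.atTop Filter.atTop :=
    Filter.tendsto_atTop_add_const_right _ _ Filter.tendsto_id
  have h1 : Filter.Tendsto (fun s : ℝ => (s + k) * ((s + k) + a)) Filter.atTop Filter.atTop :=
    hr.atTop_mul_atTop₀ (Filter.tendsto_atTop_add_const_right _ _ hr)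
  have hc : Filter.Tendsto (fun s : ℝ => - (α + n / (s + 2 * k)) ^ 2 - (β + m / s) ^ 2
      + b * (α + n / (s + 2 * k)) + c * (β + m / s) + d) Filter.atTop
      (nhds (- (α + 0) ^ 2 - (β + 0) ^ 2 + b * (α + 0) + c * (β + 0) + d)) := by
    have hX' := hX.const_add α
    have hY' := hY.const_add β
    exact ((((hX'.pow 2).neg.sub (hY'.pow 2)).add (hX'.const_mul b)).add
      (hY'.const_mul c)).add_const d
  obtain ⟨s, hs, hs'⟩ := (((h1.atTop_add hc).eventually_gt_atTop 0).and
    (Filter.eventually_gt_atTop 0)).exists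
  exact ⟨s, hs', by linarith⟩

lemma exists_concave_quadratic_eq_zero (e c y : ℝ) (h : 0 ≤ e - y ^ 2 + c * y) :
    ∃ Y : ℝ, e - Y ^ 2 + c * Y = 0 := by
  have hd : 0 ≤ c ^ 2 + 4 * e := by nlinarith [sq_nonneg (2 * y - c)]
  refine ⟨(c + √(c ^ 2 + 4 * e)) / 2, ?_⟩
  linear_combination (-1 / 4) * Real.sq_sqrt hd

/-- Two linear equations in `X`, `Y` with a pole parameter `r`, and an indefinite quadratic one. -/
lemma exists_real_solution (k : ℝ) (hk : 0 ≤ k) (α₁ α₂ δ₁ δ₂ a b c d : ℝ) :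
    ∃ r X Y : ℝ, (r + k) * X + α₁ * r + δ₁ = 0 ∧ (r - k) * Y + α₂ * r + δ₂ = 0 ∧
      r ^ 2 - X ^ 2 - Y ^ 2 + a * r + b * X + c * Y + d = 0 := by
  -- With `r = s + k` the linear equations give `X = -(α₁ + n / (s + 2k))` and `Y = -(α₂ + m / s)`.
  -- The quadratic then becomes a function of `s` alone, positive at `S`.
  obtain ⟨S, hS, hpos⟩ := exists_pos_quadratic_of_bounded_perturbation k a (-b) (-c) d α₁ α₂
    (α₂ * k + δ₂) (δ₁ - α₁ * k)
  set m := α₂ * k + δ₂ with hm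
  set n := δ₁ - α₁ * k with hn
  -- This is the case without a pole at `s = 0`: `Y` has one unless `m = 0`, and `X` has one only if
  -- `k = 0` and `n ≠ 0`.
  by_cases hm0 : m = 0 ∧ (0 < k ∨ n = 0)
  · obtain ⟨hm0, hkn⟩ := hm0
    set f : ℝ → ℝ := fun s => (s + k) ^ 2 - (α₁ + n / (s + 2 * k)) ^ 2 - α₂ ^ 2
      + a * (s + k) - b * (α₁ + n / (s + 2 * k)) - c * α₂ + d with hfd
    have hXeq : ∀ s, 0 ≤ s → (s + k + k) * -(α₁ + n / (s + 2 * k)) + α₁ * (s + k) + δ₁ = 0 := by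
      intro s hs
      by_cases h0 : s + 2 * k = 0
      · have hk0 : k = 0 := by linarith
        have hs0 : s = 0 := by linarith
        have : n = 0 := by
          rcases hkn with h | h
          · linarith
          · exact h
        simp only [hk0, hs0] at hn ⊢
        linarith
      · linear_combination hn - mul_div_cancel₀ n h0
    have hfc : ContinuousOn f (Set.Ici 0) := by
      have hX : ContinuousOn (fun s : ℝ => n / (s + 2 * k)) (Set.Ici 0) := by
        rcases hkn with h | h
        · refine continuousOn_const.div (by fun_prop) fun s hs => ?_
          have : (0 : ℝ) ≤ s := hs
          positivity
        · simp only [h, zero_div]; exact continuousOn_const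
      simp only [hfd]
      fun_prop
    by_cases hf0 : f 0 ≤ 0
    · have hfS : 0 ≤ f S := by
        rw [hm0] at hpos
        simp only [hfd]
        simp only [zero_div, add_zero] at hpos
        linarith
      obtain ⟨s, hs, hfs⟩ := exists_zero_of_nonpos_of_nonneg hfc hf0 hS hfS
      refine ⟨s + k, -(α₁ + n / (s + 2 * k)), -α₂, hXeq s hs, by linarith, ?_⟩
      simp only [hfd] at hfs
      linarith
    -- At `r = k` the second linear equation reads `m = 0` and leaves `Y` free, so a suitable `Y`
    -- brings the positive value down to zero.
    · push Not at hf0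
      simp only [hfd, zero_add] at hf0
      obtain ⟨Y, hY⟩ := exists_concave_quadratic_eq_zero (k ^ 2 - (α₁ + n / (2 * k)) ^ 2
        + a * k - b * (α₁ + n / (2 * k)) + d) c (-α₂) (by linarith)
      refine ⟨k, -(α₁ + n / (2 * k)), Y, ?_, by linarith, by linarith⟩
      have := hXeq 0 le_rfl
      simpa using this
  · by_cases hk0 : k = 0
    · subst hk0
      have hmn : 0 < m ^ 2 + n ^ 2 := by
        by_contra h
        have h1 : m = 0 := by nlinarith [sq_nonneg m, sq_nonneg n]
        have h2 : n = 0 := by nlinarith [sq_nonneg m, sq_nonneg n]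
        exact hm0 ⟨h1, Or.inr h2⟩
      -- Multiplying by `s²` clears the poles, and `g 0 = -(n² + m²) < 0` is the negative end; it
      -- also keeps the zero away from `s = 0`.
      set g : ℝ → ℝ := fun s => s ^ 4 - (α₁ * s + n) ^ 2 - (α₂ * s + m) ^ 2 + a * s ^ 3
        - b * s * (α₁ * s + n) - c * s * (α₂ * s + m) + d * s ^ 2 with hg
      have hgS : 0 ≤ g S := by
        have : g S = S ^ 2 * ((S + 0) ^ 2 - (α₁ + n / (S + 2 * 0)) ^ 2 - (α₂ + m / S) ^ 2
            + a * (S + 0) + -b * (α₁ + n / (S + 2 * 0)) + -c * (α₂ + m / S) + d) := by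
          simp only [hg, mul_zero, add_zero]
          field_simp
          ring
        rw [this]; positivity
      obtain ⟨s, hs, hgs⟩ := exists_zero_of_nonpos_of_nonneg (f := g)
        (by simp only [hg]; fun_prop) (by simp only [hg]; nlinarith) hS hgS
      have hs0 : s ≠ 0 := by
        rintro rfl
        simp only [hg] at hgs
        nlinarith
      refine ⟨s, -(α₁ + n / s), -(α₂ + m / s), ?_, ?_, ?_⟩
      · field_simp; rw [hn]; ring
      · field_simp; rw [hm]; ring
      · have : s ^ 2 * (s ^ 2 - (-(α₁ + n / s)) ^ 2 - (-(α₂ + m / s)) ^ 2 + a * s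
            + b * -(α₁ + n / s) + c * -(α₂ + m / s) + d) = g s := by
          simp only [hg]
          field_simp
          ring
        rw [hgs] at this
        exact (mul_eq_zero.mp this).resolve_left (pow_ne_zero 2 hs0)
    · have hkpos : 0 < k := lt_of_le_of_ne hk (Ne.symm hk0)
      have hm1 : m ≠ 0 := fun h => hm0 ⟨h, Or.inl hkpos⟩
      have hm2 : 0 < m ^ 2 := by positivity
      -- Only `Y` has a pole here. Clearing it with `s²` gives `g 0 = -m² < 0`.
      set g : ℝ → ℝ := fun s => s ^ 2 * ((s + k) ^ 2 - (α₁ + n / (s + 2 * k)) ^ 2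
        + a * (s + k) - b * (α₁ + n / (s + 2 * k)) + d) - (α₂ * s + m) ^ 2
        - c * s * (α₂ * s + m) with hg
      have hgc : ContinuousOn g (Set.Ici 0) := by
        have hX : ContinuousOn (fun s : ℝ => n / (s + 2 * k)) (Set.Ici 0) := by
          refine continuousOn_const.div (by fun_prop) fun s hs => ?_
          have : (0 : ℝ) ≤ s := hs
          positivity
        simp only [hg]
        fun_prop
      have hgeq : ∀ s, 0 < s → g s = s ^ 2 * ((s + k) ^ 2 - (α₁ + n / (s + 2 * k)) ^ 2
          - (α₂ + m / s) ^ 2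
            + a * (s + k) + -b * (α₁ + n / (s + 2 * k)) + -c * (α₂ + m / s) + d) := by
        intro s hs
        have h1 : s * (α₂ + m / s) = α₂ * s + m := by field_simp
        simp only [hg]
        rw [← h1]; ring
      obtain ⟨s, hs, hgs⟩ := exists_zero_of_nonpos_of_nonneg hgc
        (by simp only [hg]; nlinarith) hS (by rw [hgeq S hS]; positivity)
      have hs0 : s ≠ 0 := by
        rintro rfl
        simp only [hg] at hgs
        nlinarith
      have hspos : 0 < s := lt_of_le_of_ne hs (Ne.symm hs0)
      refine ⟨s + k, -(α₁ + n / (s + 2 * k)), -(α₂ + m / s), ?_, ?_, ?_⟩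
      · have : s + 2 * k ≠ 0 := by positivity
        linear_combination hn - mul_div_cancel₀ n this
      · field_simp; rw [hm]; ring
      · rw [hgeq s hspos] at hgs
        have := (mul_eq_zero.mp hgs).resolve_left (pow_ne_zero 2 hs0)
        linarith

/-- Since `k` and `r` are real, the real and imaginary parts of the first equation decouple, with
coefficients `r + k` and `r - k`. -/
lemma exists_complex_solution (k : ℝ) (hk : 0 ≤ k) (α δ a b : ℂ) (d : ℝ) :
    ∃ (r : ℝ) (z : ℂ), r * z + α * r + k * star z + δ = 0 ∧
      r ^ 2 - Complex.normSq z + 2 * (a * r).re + 2 * (b * z).re + d = 0 := by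
  obtain ⟨r, X, Y, h1, h2, h3⟩ := exists_real_solution k hk α.re α.im δ.re δ.im (2 * a.re)
    (2 * b.re) (-2 * b.im) d
  refine ⟨r, ⟨X, Y⟩, ?_, ?_⟩
  · apply Complex.ext <;> simp <;> linarith
  · simp [Complex.normSq_mk]; linarith

/-- The Hopf map is onto. -/
lemma exists_hopf (g : ℝ) (h : ℂ) :
    ∃ z w : ℂ, Complex.normSq z - Complex.normSq w = g ∧ star z * w = h := by
  by_cases hg : h = 0 ∧ g ≤ 0
  · refine ⟨0, (√(-g) : ℝ), ?_, by simp [hg.1]⟩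
    rw [Complex.normSq_ofReal, Real.mul_self_sqrt (by linarith [hg.2])]; simp
  -- The prescribed data force `|z|² + |w|² = R`, hence `|z|² = (g + R) / 2`; the phase is fixed by
  -- taking `z` real.
  · set R := √(g ^ 2 + 4 * Complex.normSq h) with hR
    have hR2 : R ^ 2 = g ^ 2 + 4 * Complex.normSq h :=
      Real.sq_sqrt (by nlinarith [sq_nonneg g, Complex.normSq_nonneg h])
    have hR0 : 0 ≤ R := Real.sqrt_nonneg _
    have hpos : 0 < g + R := by
      by_contra hc
      have h1 : Complex.normSq h ≤ 0 := by nlinarith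
      have h2 : h = 0 := Complex.normSq_eq_zero.mp (le_antisymm h1 (Complex.normSq_nonneg h))
      exact hg ⟨h2, by linarith⟩
    set t := √((g + R) / 2) with ht
    have ht2 : t * t = (g + R) / 2 := Real.mul_self_sqrt (by linarith)
    have ht0 : 0 < t := Real.sqrt_pos.mpr (by linarith)
    refine ⟨t, h / t, ?_, ?_⟩
    · rw [Complex.normSq_div, Complex.normSq_ofReal, ht2]
      field_simp
      linarith
    · have : (t : ℂ) ≠ 0 := by exact_mod_cast ht0.ne'
      simp; field_simp

/-- The sesquilinear form `xᴴ A y`. -/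
def sesqForm {N : ℕ} (A : Matrix (Fin N) (Fin N) ℂ) (x y : Fin N → ℂ) : ℂ :=
  star x ⬝ᵥ A.mulVec y

/-! ### Sesquilinear forms of matrices -/

section SesqForm

variable {N : ℕ} (A B : Matrix (Fin N) (Fin N) ℂ) (x y z : Fin N → ℂ)

lemma sesqForm_add_left : sesqForm A (x + y) z = sesqForm A x z + sesqForm A y z := by
  simp [sesqForm, add_dotProduct]

lemma sesqForm_add_right : sesqForm A x (y + z) = sesqForm A x y + sesqForm A x z := by
  simp [sesqForm, Matrix.mulVec_add, dotProduct_add]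

lemma sesqForm_smul_left (c : ℂ) : sesqForm A (c • x) y = star c * sesqForm A x y := by
  simp [sesqForm]

lemma sesqForm_smul_right (c : ℂ) : sesqForm A x (c • y) = c * sesqForm A x y := by
  simp [sesqForm, Matrix.mulVec_smul]

lemma sesqForm_matrix_add : sesqForm (A + B) x y = sesqForm A x y + sesqForm B x y := by
  simp [sesqForm, Matrix.add_mulVec, dotProduct_add]

lemma sesqForm_matrix_sub : sesqForm (A - B) x y = sesqForm A x y - sesqForm B x y := by
  simp [sesqForm, Matrix.sub_mulVec, dotProduct_sub]

lemma sesqForm_matrix_smul (c : ℂ) : sesqForm (c • A) x y = c * sesqForm A x y := by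
  simp [sesqForm, Matrix.smul_mulVec]

lemma sesqForm_matrix_real_smul (c : ℝ) : sesqForm (c • A) x y = c * sesqForm A x y := by
  simp [sesqForm, Matrix.smul_mulVec]

lemma sesqForm_matrix_sum {ι : Type*} (s : Finset ι) (F : ι → Matrix (Fin N) (Fin N) ℂ) :
    sesqForm (∑ i ∈ s, F i) x y = ∑ i ∈ s, sesqForm (F i) x y := by
  simp [sesqForm, Matrix.sum_mulVec, dotProduct_sum]

variable {A}

lemma sesqForm_star (hA : A.IsHermitian) : star (sesqForm A x y) = sesqForm A y x := by
  unfold sesqForm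
  rw [Matrix.star_dotProduct, Matrix.star_mulVec, hA.eq, Matrix.dotProduct_mulVec, star_star]

lemma sesqForm_self_im (hA : A.IsHermitian) : (sesqForm A x x).im = 0 := by
  have := sesqForm_star x x hA
  exact Complex.conj_eq_iff_im.mp this

end SesqForm

lemma exists_phase (β : ℂ) : ∃ ω : ℂ, ω ≠ 0 ∧ ω * β = (‖β‖ : ℂ) := by
  by_cases h : β = 0
  · exact ⟨1, one_ne_zero, by simp [h]⟩
  · exact ⟨‖β‖ / β, div_ne_zero (by simpa using h) h, div_mul_cancel₀ _ h⟩

/-! ### Common isotropic vectors of three Hermitian forms -/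

section CommonZero

variable {N : ℕ}

/-- If `A`, `D` restrict to `span (u, v)` as the Pauli matrix `σ_z` and the ladder operator, then a
further vector allows to solve both quadratic equations. -/
lemma exists_common_zero_of_pauli_aux {A D : Matrix (Fin N) (Fin N) ℂ} (hA : A.IsHermitian)
    {u v e : Fin N → ℂ} (hAu : sesqForm A u u = 1) (hAv : sesqForm A v v = -1)
    (hAuv : sesqForm A u v = 0) (hDu : sesqForm D u u = 0) (hDv : sesqForm D v v = 0)
    (hDuv : sesqForm D u v = 1) (hDvu : sesqForm D v u = 0)
    (hue : sesqForm D u e = 0) (hev : sesqForm D e v = 0) {k : ℝ} (hk : 0 ≤ k)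
    (hve : sesqForm D v e = k) :
    ∃ z₁ z₂ : ℂ, sesqForm D (z₁ • u + z₂ • v + e) (z₁ • u + z₂ • v + e) = 0 ∧
      sesqForm A (z₁ • u + z₂ • v + e) (z₁ • u + z₂ • v + e) = 0 := by
  obtain ⟨r, z, h1, h2⟩ := exists_complex_solution k hk (sesqForm D e u) (sesqForm D e e)
    (sesqForm A e u) (sesqForm A e v) (sesqForm A e e).re
  refine ⟨r, z, ?_, ?_⟩
  · simp only [sesqForm_add_left, sesqForm_add_right, sesqForm_smul_left, sesqForm_smul_right,
      hDu, hDv, hDuv, hDvu, hue, hev, hve]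
    simp only [Complex.star_def, Complex.conj_ofReal] at h1 ⊢
    linear_combination h1
  · have hvu : sesqForm A v u = 0 := by rw [← sesqForm_star u v hA, hAuv, star_zero]
    have hee := sesqForm_self_im e hA
    simp only [sesqForm_add_left, sesqForm_add_right, sesqForm_smul_left, sesqForm_smul_right,
      hAu, hAv, hAuv, hvu, ← sesqForm_star e u hA, ← sesqForm_star e v hA]
    apply Complex.ext
    · simp [Complex.normSq_apply] at h2 ⊢
      linarith
    · simp [hee]
      ring

/-- Reduction to the normalized third vector: adding multiples of `u` and `v` to `e` kills `D(u, e)`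
and `D(e, v)` without changing `D(v, e)`, and a scalar `ω` makes `D(v, e)` real and nonnegative. -/
lemma exists_common_zero_of_pauli {A D : Matrix (Fin N) (Fin N) ℂ} (hA : A.IsHermitian)
    {u v : Fin N → ℂ} (hAu : sesqForm A u u = 1) (hAv : sesqForm A v v = -1)
    (hAuv : sesqForm A u v = 0) (hDu : sesqForm D u u = 0) (hDv : sesqForm D v v = 0)
    (hDuv : sesqForm D u v = 1) (hDvu : sesqForm D v u = 0) (e : Fin N → ℂ) :
    ∃ z₁ z₂ t : ℂ, t ≠ 0 ∧ sesqForm D (z₁ • u + z₂ • v + t • e) (z₁ • u + z₂ • v + t • e) = 0 ∧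
      sesqForm A (z₁ • u + z₂ • v + t • e) (z₁ • u + z₂ • v + t • e) = 0 := by
  obtain ⟨ω, hω, hωe⟩ := exists_phase (sesqForm D v e)
  set p := sesqForm D u e with hp
  set q := sesqForm D e v with hq
  obtain ⟨z₁, z₂, h1, h2⟩ := exists_common_zero_of_pauli_aux (e := ω • (e + (-p) • v + (-star q) • u))
    hA hAu hAv hAuv hDu hDv hDuv hDvu
    (by simp only [sesqForm_add_right, sesqForm_smul_right, hDuv, hDu, ← hp]; ring)
    (by simp only [sesqForm_add_left, sesqForm_smul_left, hDuv, hDv, ← hq, star_neg, star_star]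
        ring)
    (norm_nonneg (sesqForm D v e))
    (by simp only [sesqForm_add_right, sesqForm_smul_right, hDvu, hDv, ← hωe]; ring)
  have heq : z₁ • u + z₂ • v + ω • (e + (-p) • v + (-star q) • u)
      = (z₁ - ω * star q) • u + (z₂ - ω * p) • v + ω • e := by module
  rw [heq] at h1 h2
  exact ⟨_, _, ω, hω, h1, h2⟩

/-- Three Hermitian forms whose values at `u` and `v` are opposite have a common nonzero isotropic
vector in any three-dimensional space that contains `u` and `v`. -/
lemma exists_common_isotropic {C : Fin 3 → Matrix (Fin N) (Fin N) ℂ}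
    (hC : ∀ i, (C i).IsHermitian) {u v e : Fin N → ℂ}
    (hind : ∀ z₁ z₂ t : ℂ, z₁ • u + z₂ • v + t • e = 0 → z₁ = 0 ∧ z₂ = 0 ∧ t = 0)
    (huv : ∀ i, sesqForm (C i) v v = - sesqForm (C i) u u) :
    ∃ w : Fin N → ℂ, w ≠ 0 ∧ ∀ i, sesqForm (C i) w w = 0 := by
  set M : Matrix (Fin 3) (Fin 3) ℝ := Matrix.of fun i =>
    ![(sesqForm (C i) u u).re, (sesqForm (C i) u v).re, (sesqForm (C i) u v).im] with hM
  have hM0 : ∀ i, sesqForm (C i) u u = M i 0 := fun i => by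
    apply Complex.ext
    · simp [hM]
    · simp [hM, sesqForm_self_im u (hC i)]
  have hM1 : ∀ i, sesqForm (C i) u v = M i 1 + Complex.I * M i 2 := fun i => by
    apply Complex.ext <;> simp [hM]
  have hM2 : ∀ i, sesqForm (C i) v u = M i 1 - Complex.I * M i 2 := fun i => by
    rw [← sesqForm_star u v (hC i)]
    apply Complex.ext <;> simp [hM]
  by_cases hdet : M.det = 0
  · obtain ⟨g, hg0, hg⟩ := Matrix.exists_mulVec_eq_zero_iff.mpr hdet
    -- The value of the `i`-th form at `z u + w v` is the product of row `i` of `M` with the Hopf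
    -- coordinates `(|z|² - |w|², 2 Re(z̄w), -2 Im(z̄w))`. These are set to the kernel vector `g`.
    obtain ⟨z, w, h1, h2⟩ := exists_hopf (g 0) (⟨g 1 / 2, -g 2 / 2⟩ : ℂ)
    refine ⟨z • u + w • v, ?_, fun i => ?_⟩
    · intro h0
      obtain ⟨hz, hw, -⟩ := hind z w 0 (by simpa using h0)
      apply hg0
      subst hz hw
      simp [Complex.ext_iff] at h1 h2
      funext j
      fin_cases j
      · exact h1.symm
      · simpa using h2.1.symm
      · simpa using h2.2.symm
    · have hgi : M i 0 * g 0 + M i 1 * g 1 + M i 2 * g 2 = 0 := by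
        have := congrFun hg i
        simpa [Matrix.mulVec, dotProduct, Fin.sum_univ_three] using this
      have h2' : star w * z = (⟨g 1 / 2, g 2 / 2⟩ : ℂ) := by
        have := congrArg star h2
        rw [star_mul, star_star] at this
        rw [this]
        apply Complex.ext <;> simp; ring
      have h1' : star z * z - star w * w = (g 0 : ℂ) := by
        rw [← h1]
        simp [Complex.normSq_eq_conj_mul_self]
      simp only [sesqForm_add_left, sesqForm_add_right, sesqForm_smul_left, sesqForm_smul_right,
        huv, hM0, hM1, hM2]
      have e1 : star z * (z * (M i 0 : ℂ)) + star z * (w * (M i 1 + Complex.I * M i 2)) +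
          (star w * (z * (M i 1 - Complex.I * M i 2)) + star w * (w * -(M i 0 : ℂ)))
          = (M i 0 : ℂ) * (star z * z - star w * w) + (M i 1 + Complex.I * M i 2) * (star z * w)
            + (M i 1 - Complex.I * M i 2) * (star w * z) := by ring
      have e2 : (M i 0 : ℂ) * (star z * z - star w * w)
          + (M i 1 + Complex.I * M i 2) * (star z * w)
            + (M i 1 - Complex.I * M i 2) * (star w * z) = 0 := by
        rw [h1', h2, h2']
        apply Complex.ext
        · simp; linarith
        · simp; ring
      linear_combination e1 + e2
  · have hunit : IsUnit M.det := isUnit_iff_ne_zero.mpr hdet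
    -- The inverse of `M` is real, so the `P j` stay Hermitian; on the span of `u` and `v` they act
    -- as Pauli matrices.
    set P : Fin 3 → Matrix (Fin N) (Fin N) ℂ := fun j => ∑ i, (M⁻¹ j i) • C i with hP
    have hPf : ∀ j x y, sesqForm (P j) x y = ∑ i, (M⁻¹ j i : ℂ) * sesqForm (C i) x y := by
      intro j x y
      simp only [hP, sesqForm_matrix_sum, sesqForm_matrix_real_smul]
    have hinv : ∀ j l, ∑ i, (M⁻¹ j i : ℂ) * (M i l : ℂ) = if j = l then 1 else 0 := by
      intro j l
      have := congrFun (congrFun (Matrix.nonsing_inv_mul M hunit) j) l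
      rw [Matrix.mul_apply, Matrix.one_apply] at this
      rw [← Complex.ofReal_one, ← Complex.ofReal_zero, ← apply_ite, ← this]
      push_cast; rfl
    have hPu : ∀ j, sesqForm (P j) u u = if j = 0 then 1 else 0 := fun j => by
      simp only [hPf, hM0, hinv]
    have hPv : ∀ j, sesqForm (P j) v v = - if j = 0 then 1 else 0 := fun j => by
      rw [← hinv]
      simp only [hPf, huv, hM0, mul_neg, Finset.sum_neg_distrib]
    have hPuv : ∀ j, sesqForm (P j) u v
        = (if j = 1 then 1 else 0) + Complex.I * if j = 2 then 1 else 0 := fun j => by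
      simp only [← hinv, hPf, hM1, mul_add, Finset.sum_add_distrib, Finset.mul_sum]
      congr 1
      exact Finset.sum_congr rfl fun i _ => by ring
    have hPvu : ∀ j, sesqForm (P j) v u
        = (if j = 1 then 1 else 0) - Complex.I * if j = 2 then 1 else 0 := fun j => by
      simp only [← hinv, hPf, hM2, mul_sub, Finset.sum_sub_distrib, Finset.mul_sum]
      congr 1
      exact Finset.sum_congr rfl fun i _ => by ring
    have hPh : ∀ j, (P j).IsHermitian := fun j => by
      simp only [hP, Matrix.IsHermitian, Matrix.conjTranspose_sum, Matrix.conjTranspose_smul,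
        (hC _).eq, star_trivial]
    obtain ⟨z₁, z₂, t, ht, hD, hA⟩ := exists_common_zero_of_pauli (u := u) (v := v)
      (D := (1 / 2 : ℂ) • (P 1 - Complex.I • P 2)) (hPh 0)
      (by simp [hPu]) (by simp [hPv]) (by simp [hPuv])
      (by simp [sesqForm_matrix_smul, sesqForm_matrix_sub, hPu])
      (by simp [sesqForm_matrix_smul, sesqForm_matrix_sub, hPv])
      (by simp [sesqForm_matrix_smul, sesqForm_matrix_sub, hPuv]; norm_num)
      (by simp [sesqForm_matrix_smul, sesqForm_matrix_sub, hPvu]) e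
    set w := z₁ • u + z₂ • v + t • e with hw
    have hPw : ∀ j, sesqForm (P j) w w = 0 := by
      -- The forms `P 1` and `P 2` are real on the diagonal, so the single complex equation for `D`
      -- makes both vanish.
      rw [sesqForm_matrix_smul, sesqForm_matrix_sub, sesqForm_matrix_smul] at hD
      have h1 := sesqForm_self_im w (hPh 1)
      have h2 := sesqForm_self_im w (hPh 2)
      simp [Complex.ext_iff, h1, h2] at hD
      intro j
      fin_cases j
      · exact hA
      · exact Complex.ext hD.1 h1
      · exact Complex.ext hD.2 h2
    refine ⟨w, fun h0 => ht (hind z₁ z₂ t h0).2.2, fun i => ?_⟩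
    have hback : C i = ∑ j, (M i j) • P j := by
      have : ∀ l, ∑ j, M i j * M⁻¹ j l = if i = l then 1 else 0 := fun l => by
        rw [← Matrix.mul_apply, Matrix.mul_nonsing_inv M hunit, Matrix.one_apply]
      simp only [hP, Finset.smul_sum, smul_smul]
      rw [Finset.sum_comm]
      simp only [← Finset.sum_smul, this]
      simp
    rw [hback, sesqForm_matrix_sum]
    simp [sesqForm_matrix_real_smul, hPw]

end CommonZero

/-! ### Quadratic values on the unit sphere -/

section QuadVal

variable {N : ℕ} (A B : Matrix (Fin N) (Fin N) ℂ) (u : EuclideanSpace ℂ (Fin N))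

lemma quadVal_eq_re_sesqForm : quadVal A u = (sesqForm A u.ofLp u.ofLp).re := rfl

lemma quadVal_add : quadVal (A + B) u = quadVal A u + quadVal B u := by
  simp [quadVal_eq_re_sesqForm, sesqForm_matrix_add]

lemma quadVal_sub : quadVal (A - B) u = quadVal A u - quadVal B u := by
  simp [quadVal_eq_re_sesqForm, sesqForm_matrix_sub]

lemma quadVal_matrix_smul (c : ℝ) : quadVal (c • A) u = c * quadVal A u := by
  simp [quadVal_eq_re_sesqForm, sesqForm_matrix_real_smul]

lemma quadVal_smul (c : ℂ) : quadVal A (c • u) = ‖c‖ ^ 2 * quadVal A u := by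
  simp only [quadVal_eq_re_sesqForm, WithLp.ofLp_smul, sesqForm_smul_left, sesqForm_smul_right]
  rw [← mul_assoc, ← Complex.normSq_eq_norm_sq]
  have : c * star c = (Complex.normSq c : ℂ) := Complex.mul_conj c
  rw [this, Complex.re_ofReal_mul]

lemma quadVal_one : quadVal (1 : Matrix (Fin N) (Fin N) ℂ) u = ‖u‖ ^ 2 := by
  rw [EuclideanSpace.norm_sq_eq]
  simp [quadVal, dotProduct, ← Complex.normSq_eq_conj_mul_self, Complex.normSq_eq_norm_sq]
  exact Finset.sum_congr rfl fun i _ => by rw [← Complex.ofReal_pow, Complex.ofReal_re]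

lemma quadVal_sub_smul_one {u : EuclideanSpace ℂ (Fin N)} (hu : u ∈ unitVectors N) (l : ℝ) :
    quadVal (A - l • (1 : Matrix (Fin N) (Fin N) ℂ)) u = quadVal A u - l := by
  have hu' : ‖u‖ = 1 := hu
  rw [quadVal_sub, quadVal_matrix_smul, quadVal_one, hu']
  ring

lemma continuous_quadVal : Continuous (quadVal A) := by
  unfold quadVal
  refine Complex.continuous_re.comp ?_
  have h : Continuous fun u : EuclideanSpace ℂ (Fin N) => u.ofLp := PiLp.continuous_ofLp 2 _
  exact (continuous_star.comp h).dotProduct (continuous_const.matrix_mulVec h)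

lemma isCompact_unitVectors (N : ℕ) : IsCompact (unitVectors N) := by
  have : unitVectors N = Metric.sphere 0 1 := by ext; simp [unitVectors]
  rw [this]
  exact isCompact_sphere 0 1

lemma unitVectors_nonempty (hN : 0 < N) : (unitVectors N).Nonempty :=
  ⟨EuclideanSpace.single ⟨0, hN⟩ 1, by simp [unitVectors]⟩

lemma normalize_mem_unitVectors {u : EuclideanSpace ℂ (Fin N)} (hu : u ≠ 0) :
    ((‖u‖⁻¹ : ℝ) : ℂ) • u ∈ unitVectors N := by
  have : ‖u‖ ≠ 0 := norm_ne_zero_iff.mpr hu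
  simp [unitVectors, norm_smul, this]

end QuadVal

/-! ### Convexity of the joint numerical range -/

section JointRange

variable {N : ℕ}

/-- The joint numerical range of three matrices. -/
def jointRange (A : Fin 3 → Matrix (Fin N) (Fin N) ℂ) : Set (Fin 3 → ℝ) :=
  (fun u i => quadVal (A i) u) '' unitVectors N

/-- The joint numerical range of three Hermitian matrices of size at least three is convex. -/
theorem convex_jointRange (hN : 3 ≤ N) {A : Fin 3 → Matrix (Fin N) (Fin N) ℂ}
    (hA : ∀ i, (A i).IsHermitian) : Convex ℝ (jointRange A) := by
  rintro _ ⟨x, hx, rfl⟩ _ ⟨y, hy, rfl⟩ a b ha hb hab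
  have hx' : ‖x‖ = 1 := hx
  have hy' : ‖y‖ = 1 := hy
  have hx0 : x ≠ 0 := by rintro rfl; simp at hx'
  rcases ha.eq_or_lt with rfl | ha
  · obtain rfl : b = 1 := by linarith
    exact ⟨y, hy, by simp⟩
  rcases hb.eq_or_lt with rfl | hb
  · obtain rfl : a = 1 := by linarith
    exact ⟨x, hx, by simp⟩
  by_cases hlin : LinearIndependent ℂ ![x, y]
  · set p : Fin 3 → ℝ := fun i => a * quadVal (A i) x + b * quadVal (A i) y with hp
    have hlt : Submodule.span ℂ (Set.range ![x, y]) < ⊤ := by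
      refine span_lt_top_of_card_lt_finrank ?_
      rw [Set.toFinset_range]
      refine lt_of_le_of_lt Finset.card_image_le ?_
      simp
      omega
    -- Here `N ≥ 3` is essential: the span of `x` and `y` leaves room for a third direction.
    obtain ⟨e, -, he⟩ := SetLike.exists_of_lt hlt
    rw [Matrix.range_cons_cons_empty] at he
    have ha2 : (√a : ℂ) ≠ 0 := by exact_mod_cast (Real.sqrt_pos.mpr ha).ne'
    have hb2 : (√b : ℂ) ≠ 0 := by exact_mod_cast (Real.sqrt_pos.mpr hb).ne'
    have hher : ∀ i, (A i - p i • (1 : Matrix (Fin N) (Fin N) ℂ)).IsHermitian := fun i => by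
      simp [Matrix.IsHermitian, (hA i).eq]
    obtain ⟨w, hw0, hw⟩ := exists_common_isotropic hher (u := ((√a : ℂ) • x).ofLp)
      (v := ((√b : ℂ) • y).ofLp) (e := e.ofLp)
      (by
        intro z₁ z₂ t h
        have h' : (z₁ * √a) • x + (z₂ * √b) • y + t • e = 0 := by
          rw [mul_smul, mul_smul]
          exact WithLp.ofLp_injective 2 h
        have ht : t = 0 := by
          by_contra ht
          apply he
          rw [Submodule.mem_span_pair]
          refine ⟨-t⁻¹ * (z₁ * √a), -t⁻¹ * (z₂ * √b), ?_⟩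
          have h2 : t • e = -((z₁ * √a) • x + (z₂ * √b) • y) :=
            eq_neg_of_add_eq_zero_right h'
          rw [← inv_smul_smul₀ ht e, h2]
          module
        subst ht
        rw [zero_smul, add_zero] at h'
        obtain ⟨h1, h2⟩ := LinearIndependent.pair_iff.mp hlin _ _ h'
        exact ⟨(mul_eq_zero.mp h1).resolve_right ha2, (mul_eq_zero.mp h2).resolve_right hb2, rfl⟩)
      (by
        intro i
        apply Complex.ext
        · rw [Complex.neg_re, ← quadVal_eq_re_sesqForm, ← quadVal_eq_re_sesqForm, quadVal_smul,
            quadVal_smul, quadVal_sub_smul_one _ hx, quadVal_sub_smul_one _ hy]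
          simp only [Complex.norm_real, Real.norm_eq_abs, sq_abs, Real.sq_sqrt ha.le,
            Real.sq_sqrt hb.le, hp]
          obtain rfl : b = 1 - a := by linarith
          ring
        · rw [Complex.neg_im, sesqForm_self_im _ (hher i), sesqForm_self_im _ (hher i), neg_zero])
    have hW : WithLp.toLp 2 w ≠ 0 := fun h => hw0 (by simpa using congrArg WithLp.ofLp h)
    refine ⟨_, normalize_mem_unitVectors hW, funext fun i => ?_⟩
    have h1 := quadVal_sub_smul_one (A i) (normalize_mem_unitVectors hW) (p i)
    rw [quadVal_smul, quadVal_eq_re_sesqForm _ (WithLp.toLp 2 w)] at h1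
    simp only [hw i, Complex.zero_re, mul_zero] at h1
    simp only [Pi.add_apply, Pi.smul_apply, smul_eq_mul]
    linarith
  · rw [LinearIndependent.pair_iff' hx0] at hlin
    push Not at hlin
    obtain ⟨ω, hω⟩ := hlin
    have hω1 : ‖ω‖ = 1 := by
      rw [← hω, norm_smul, hx', mul_one] at hy'
      exact hy'
    refine ⟨x, hx, funext fun i => ?_⟩
    simp only [Pi.add_apply, Pi.smul_apply, smul_eq_mul, ← hω, quadVal_smul, hω1]
    linear_combination (- quadVal (A i) x) * hab

end JointRange

/-! ### The smallest eigenvalue and the Rayleigh principle -/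

section LambdaMin

variable {N : ℕ} {A : Matrix (Fin N) (Fin N) ℂ}

lemma posSemidef_iff_quadVal (hA : A.IsHermitian) :
    A.PosSemidef ↔ ∀ u ∈ unitVectors N, 0 ≤ quadVal A u := by
  rw [Matrix.posSemidef_iff_dotProduct_mulVec]
  constructor
  · intro h u _
    exact (Complex.le_def.mp (h.2 u.ofLp)).1
  · intro h
    refine ⟨hA, fun x => ?_⟩
    refine Complex.le_def.mpr ⟨?_, (sesqForm_self_im x hA).symm⟩
    change 0 ≤ quadVal A (WithLp.toLp 2 x)
    by_cases hx : WithLp.toLp 2 x = 0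
    · rw [hx]; simp [quadVal]
    · have h1 := h _ (normalize_mem_unitVectors hx)
      rw [quadVal_smul] at h1
      have h2 : 0 < ‖((‖WithLp.toLp 2 x‖⁻¹ : ℝ) : ℂ)‖ ^ 2 := by
        have := norm_pos_iff.mpr hx
        rw [Complex.norm_real, Real.norm_eq_abs, sq_abs]
        exact pow_pos (inv_pos.mpr this) 2
      exact nonneg_of_mul_nonneg_right h1 h2

lemma isHermitian_sub_smul_one (hA : A.IsHermitian) (l : ℝ) :
    (A - l • (1 : Matrix (Fin N) (Fin N) ℂ)).IsHermitian := by
  simp [Matrix.IsHermitian, hA.eq]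

lemma posSemidef_sub_smul_one_iff (hA : A.IsHermitian) (l : ℝ) :
    (A - l • (1 : Matrix (Fin N) (Fin N) ℂ)).PosSemidef ↔
      ∀ u ∈ unitVectors N, l ≤ quadVal A u := by
  rw [posSemidef_iff_quadVal (isHermitian_sub_smul_one hA l)]
  refine forall₂_congr fun u hu => ?_
  rw [quadVal_sub_smul_one A hu, sub_nonneg]

lemma quadVal_of_eigenvector {u : EuclideanSpace ℂ (Fin N)} (hu : u ∈ unitVectors N) {r : ℝ}
    (h : A.mulVec u.ofLp = (r : ℂ) • u.ofLp) : quadVal A u = r := by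
  have h1 := quadVal_one u
  have hu' : ‖u‖ = 1 := hu
  rw [quadVal, Matrix.one_mulVec, hu'] at h1
  rw [quadVal, h, dotProduct_smul, smul_eq_mul, Complex.re_ofReal_mul, h1]
  simp

/-- After subtraction of the minimum the matrix is positive semidefinite and its form vanishes at
`u`; an isotropic vector of a positive semidefinite form lies in the kernel. -/
lemma eigenvector_of_isMin (hA : A.IsHermitian) {u : EuclideanSpace ℂ (Fin N)}
    (hmin : ∀ v ∈ unitVectors N, quadVal A u ≤ quadVal A v) (hu : u ∈ unitVectors N) :
    A.mulVec u.ofLp = (quadVal A u : ℂ) • u.ofLp := by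
  have hps := (posSemidef_sub_smul_one_iff hA (quadVal A u)).mpr hmin
  have h0 : star u.ofLp ⬝ᵥ
      (A - quadVal A u • (1 : Matrix (Fin N) (Fin N) ℂ)).mulVec u.ofLp = 0 := by
    apply Complex.ext
    · have := quadVal_sub_smul_one A hu (quadVal A u)
      rw [sub_self] at this
      exact this
    · exact sesqForm_self_im _ (isHermitian_sub_smul_one hA _)
  have h1 := (hps.dotProduct_mulVec_zero_iff u.ofLp).mp h0
  rw [Matrix.sub_mulVec, Matrix.smul_mulVec, Matrix.one_mulVec, sub_eq_zero] at h1
  rw [h1]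
  ext i
  simp

/-- The Rayleigh principle. -/
lemma isLeast_lambdaMin (hN : 0 < N) (hA : A.IsHermitian) :
    IsLeast (quadVal A '' unitVectors N) (lambdaMin A) := by
  obtain ⟨u, hu, hmin⟩ := (isCompact_unitVectors N).exists_isMinOn (unitVectors_nonempty hN)
    (continuous_quadVal A).continuousOn
  have hmin' : ∀ v ∈ unitVectors N, quadVal A u ≤ quadVal A v := fun v hv => hmin hv
  have hu0 : u.ofLp ≠ 0 := by
    intro h
    have hu' : ‖u‖ = 1 := hu
    have : u = 0 := WithLp.ofLp_injective 2 h
    simp [this] at hu'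
  have hl : IsLeast {r : ℝ | Module.End.HasEigenvalue (Matrix.toLin' A) (r : ℂ)}
      (quadVal A u) := by
    constructor
    · refine Module.End.hasEigenvalue_of_hasEigenvector (x := u.ofLp)
        ⟨Module.End.mem_eigenspace_iff.mpr ?_, hu0⟩
      rw [Matrix.toLin'_apply]
      exact eigenvector_of_isMin hA hmin' hu
    · intro r hr
      obtain ⟨x, hx, hx0⟩ := Module.End.HasEigenvalue.exists_hasEigenvector hr
      rw [Module.End.mem_eigenspace_iff, Matrix.toLin'_apply] at hx
      have hX : WithLp.toLp 2 x ≠ 0 := fun h => hx0 (by simpa using congrArg WithLp.ofLp h)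
      have hn := normalize_mem_unitVectors hX
      rw [← quadVal_of_eigenvector hn (r := r) (by
        rw [WithLp.ofLp_smul, Matrix.mulVec_smul, hx, smul_comm])]
      exact hmin' _ hn
  have heq : lambdaMin A = quadVal A u := hl.csInf_eq
  rw [heq]
  exact ⟨⟨u, hu, rfl⟩, by rintro _ ⟨v, hv, rfl⟩; exact hmin' v hv⟩

lemma le_lambdaMin_iff (hN : 0 < N) (hA : A.IsHermitian) {l : ℝ} :
    l ≤ lambdaMin A ↔ ∀ u ∈ unitVectors N, l ≤ quadVal A u := by
  obtain ⟨⟨u, hu, h⟩, hl⟩ := isLeast_lambdaMin hN hA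
  exact ⟨fun h v hv => h.trans (hl ⟨v, hv, rfl⟩), fun h' => h ▸ h' u hu⟩

lemma posSemidef_sub_smul_one_iff_le_lambdaMin (hN : 0 < N) (hA : A.IsHermitian) {l : ℝ} :
    (A - l • (1 : Matrix (Fin N) (Fin N) ℂ)).PosSemidef ↔ l ≤ lambdaMin A := by
  rw [le_lambdaMin_iff hN hA, posSemidef_sub_smul_one_iff hA]

end LambdaMin

/-! ### Lagrange duality by separation -/

section Duality

variable {E : Type*} [NormedAddCommGroup E] [NormedSpace ℝ E] {W : Set (ℝ × E)}

lemma strongDual_prod_apply (f : StrongDual ℝ (ℝ × E)) (x : ℝ) (y : E) :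
    f (x, y) = x * f (1, 0) + f (0, y) := by
  have : (x, y) = x • ((1, 0) : ℝ × E) + (0, y) := by simp
  rw [this, map_add, map_smul, smul_eq_mul]

lemma strongDual_prod_apply_zero (f : StrongDual ℝ (ℝ × E)) (x : ℝ) :
    f (x, 0) = x * f (1, 0) := by
  rw [strongDual_prod_apply f x 0, show f (0, 0) = 0 from map_zero f, add_zero]

/-- Separation of the part of the vertical axis up to height `l` from a compact convex set. -/
lemma exists_functional_of_lt (hWc : Convex ℝ W) (hWk : IsCompact W) {l : ℝ}
    (hl : ∀ x, (x, (0 : E)) ∈ W → l < x) :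
    ∃ f : StrongDual ℝ (ℝ × E), 0 ≤ f (1, 0) ∧ ∀ w ∈ W, l * f (1, 0) < f w := by
  have hS : IsClosed (Set.Iic l ×ˢ ({0} : Set E)) := isClosed_Iic.prod isClosed_singleton
  obtain ⟨f, a, b, ha, hab, hb⟩ := geometric_hahn_banach_closed_compact
    ((convex_Iic l).prod (convex_singleton (0 : E))) hS hWc hWk
    (Set.disjoint_left.mpr (by
      rintro ⟨x, y⟩ ⟨hx, hy⟩ hw
      obtain rfl : y = 0 := hy
      exact absurd (hl x hw) (not_lt.mpr hx)))
  have hval : ∀ x ≤ l, x * f (1, 0) < a := fun x hx => by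
    have h := ha (x, 0) ⟨hx, rfl⟩
    rwa [strongDual_prod_apply_zero] at h
  refine ⟨f, ?_, fun w hw => (hval l le_rfl).trans (hab.trans (hb w hw))⟩
  by_contra hneg
  push Not at hneg
  -- With a negative slope, `f` would reach the bound `a` far enough down the ray.
  have h1 := hval (min l (a / f (1, 0))) (min_le_left _ _)
  have h2 : a ≤ min l (a / f (1, 0)) * f (1, 0) := by
    calc a = a / f (1, 0) * f (1, 0) := (div_mul_cancel₀ _ hneg.ne).symm
      _ ≤ _ := mul_le_mul_of_nonpos_right (min_le_right _ _) hneg.le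
  linarith

/-- If `W` meets the axis, the separating hyperplane cannot be vertical and is normalized to slope
one. Otherwise the projection of `W` is strictly separated from `0`, and a large multiple of the
separating functional outweighs the bounded first coordinate. -/
lemma exists_multiplier_of_lt (hWc : Convex ℝ W) (hWk : IsCompact W) {l : ℝ}
    (hl : ∀ x, (x, (0 : E)) ∈ W → l < x) :
    ∃ g : StrongDual ℝ E, ∀ x y, (x, y) ∈ W → l ≤ x + g y := by
  by_cases hne : ∃ x, (x, (0 : E)) ∈ W
  · obtain ⟨x₀, hx₀⟩ := hne
    obtain ⟨f, hf0, hf⟩ := exists_functional_of_lt hWc hWk hl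
    have hpos : 0 < f (1, 0) := by
      refine lt_of_le_of_ne hf0 fun h => ?_
      have := hf _ hx₀
      rw [strongDual_prod_apply_zero f x₀, ← h] at this
      simp at this
    refine ⟨(f (1, 0))⁻¹ • f.comp (ContinuousLinearMap.inr ℝ ℝ E), fun x y hxy => ?_⟩
    have h := hf _ hxy
    rw [strongDual_prod_apply f x y] at h
    have h1 : f (1, 0) * (l - x) < f (0, y) := by linarith
    have h2 : l - x ≤ (f (1, 0))⁻¹ * f (0, y) := by
      rw [inv_mul_eq_div, le_div_iff₀ hpos]
      linarith
    simp only [_root_.smul_apply, ContinuousLinearMap.comp_apply,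
      ContinuousLinearMap.inr_apply, smul_eq_mul]
    linarith
  · have hPc : Convex ℝ (Prod.snd '' W) := hWc.linear_image (LinearMap.snd ℝ ℝ E)
    have hPk : IsCompact (Prod.snd '' W) := hWk.image continuous_snd
    obtain ⟨g, v, hv, hg⟩ := geometric_hahn_banach_point_closed (x := (0 : E)) hPc hPk.isClosed
      (by rintro ⟨⟨x, y⟩, hw, hy⟩; exact hne ⟨x, by simpa [← hy] using hw⟩)
    rw [map_zero] at hv
    obtain ⟨m, hm⟩ := (hWk.image continuous_fst).bddBelow
    set t := max 0 ((l - m) / v) with ht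
    refine ⟨t • g, fun x y hxy => ?_⟩
    have h1 : m ≤ x := hm ⟨_, hxy, rfl⟩
    have h2 : v < g y := hg _ ⟨_, hxy, rfl⟩
    have h3 : l - m ≤ t * v := by
      rw [← div_le_iff₀ hv]; exact le_max_right _ _
    have h4 : t * v ≤ t * g y := mul_le_mul_of_nonneg_left h2.le (le_max_left _ _)
    simp only [_root_.smul_apply, smul_eq_mul]
    linarith

/-- Attainment in the dual problem under the absence of a nonnegative functional. -/
lemma exists_multiplier_of_le [FiniteDimensional ℝ E] (hWc : Convex ℝ W) (hWk : IsCompact W)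
    (hWne : W.Nonempty) {p : ℝ} (hp : ∀ x, (x, (0 : E)) ∈ W → p ≤ x)
    (hneg : ∀ g : StrongDual ℝ E, g ≠ 0 → ∃ w ∈ W, g w.2 < 0) :
    ∃ g : StrongDual ℝ E, ∀ x y, (x, y) ∈ W → p ≤ x + g y := by
  -- Separating functionals for heights increasing to `p` are scaled to norm one; a limit exists by
  -- compactness and is nonzero.
  have key : ∀ n : ℕ, ∃ f ∈ Metric.sphere (0 : StrongDual ℝ (ℝ × E)) 1, 0 ≤ f (1, 0) ∧
      ∀ w ∈ W, (p - 1 / (n + 1)) * f (1, 0) ≤ f w := by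
    intro n
    have hn : (0 : ℝ) < 1 / (n + 1) := Nat.one_div_pos_of_nat
    obtain ⟨f, hf0, hf⟩ := exists_functional_of_lt (l := p - 1 / (n + 1)) hWc hWk
      (fun x hx => by linarith [hp x hx])
    have hfne : f ≠ 0 := by
      rintro rfl
      obtain ⟨w, hw⟩ := hWne
      simpa using hf w hw
    have hnorm : 0 < ‖f‖ := norm_pos_iff.mpr hfne
    refine ⟨‖f‖⁻¹ • f, by simp [norm_smul, hnorm.ne'], ?_, fun w hw => ?_⟩
    · simp only [_root_.smul_apply, smul_eq_mul]
      positivity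
    · simp only [_root_.smul_apply, smul_eq_mul]
      rw [mul_left_comm]
      exact mul_le_mul_of_nonneg_left (hf w hw).le (by positivity)
  choose F hFs hF0 hF using key
  have : ProperSpace (StrongDual ℝ (ℝ × E)) := FiniteDimensional.proper ℝ _
  obtain ⟨f, hfs, φ, hφ, hlim⟩ := (isCompact_sphere (0 : StrongDual ℝ (ℝ × E)) 1).tendsto_subseq hFs
  have happ : ∀ w, Filter.Tendsto (fun n => F (φ n) w) Filter.atTop (nhds (f w)) := fun w =>
    ((ContinuousLinearMap.apply ℝ ℝ w).continuous.tendsto f).comp hlim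
  have hf0 : 0 ≤ f (1, 0) := ge_of_tendsto' (happ _) fun n => hF0 _
  have hf : ∀ w ∈ W, p * f (1, 0) ≤ f w := by
    intro w hw
    have h1 : Filter.Tendsto (fun n : ℕ => p - 1 / ((φ n : ℝ) + 1)) Filter.atTop (nhds (p - 0)) :=
      ((tendsto_one_div_add_atTop_nhds_zero_nat (𝕜 := ℝ)).comp hφ.tendsto_atTop).const_sub p
    rw [sub_zero] at h1
    exact le_of_tendsto_of_tendsto' (h1.mul (happ (1, 0))) (happ w) fun n => hF _ w hw
  -- If the limit hyperplane were vertical, its second component would be a nonzero functional that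
  -- is nonnegative on `W`, against `hneg`.
  have hpos : 0 < f (1, 0) := by
    refine lt_of_le_of_ne hf0 fun h => ?_
    by_cases hg : f.comp (ContinuousLinearMap.inr ℝ ℝ E) = 0
    · have : f = 0 := by
        ext
        · simp [← h]
        · exact DFunLike.congr_fun hg _
      rw [this] at hfs
      simp at hfs
    · obtain ⟨⟨x, y⟩, hw, hlt⟩ := hneg _ hg
      have h2 := hf _ hw
      rw [strongDual_prod_apply f x y, ← h] at h2
      simp only [ContinuousLinearMap.comp_apply, ContinuousLinearMap.inr_apply] at hlt
      linarith
  refine ⟨(f (1, 0))⁻¹ • f.comp (ContinuousLinearMap.inr ℝ ℝ E), fun x y hxy => ?_⟩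
  have h := hf _ hxy
  rw [strongDual_prod_apply f x y] at h
  have h2 : p - x ≤ (f (1, 0))⁻¹ * f (0, y) := by
    rw [inv_mul_eq_div, le_div_iff₀ hpos]
    linarith
  simp only [_root_.smul_apply, ContinuousLinearMap.comp_apply,
    ContinuousLinearMap.inr_apply, smul_eq_mul]
  linarith

/-- The minimax theorem for the largest coordinate on a convex set. -/
lemma exists_weights_of_le_max {ι : Type*} [Fintype ι] [DecidableEq ι] {W : Set (ι → ℝ)}
    (hW : Convex ℝ W) {c : ℝ} (hc : ∀ x ∈ W, ∃ i, c ≤ x i) (hne : W.Nonempty) :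
    ∃ μ : ι → ℝ, (∀ i, 0 ≤ μ i) ∧ ∑ i, μ i = 1 ∧ ∀ x ∈ W, c ≤ ∑ i, μ i * x i := by
  have hS : IsOpen (Set.univ.pi fun _ : ι => Set.Iio c) :=
    isOpen_set_pi Set.finite_univ fun _ _ => isOpen_Iio
  obtain ⟨f, a, ha, hb⟩ := geometric_hahn_banach_open
    (convex_pi fun _ _ => convex_Iio c) hS hW
    (Set.disjoint_left.mpr fun x hx hxW => by
      obtain ⟨i, hi⟩ := hc x hxW
      exact absurd (hx i trivial) (not_lt.mpr hi))
  set ν : ι → ℝ := fun i => f (Pi.single i 1) with hν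
  have hfν : ∀ x, f x = ∑ i, ν i * x i := by
    intro x
    conv_lhs => rw [pi_eq_sum_univ' x, map_sum]
    exact Finset.sum_congr rfl fun i _ => by rw [map_smul, smul_eq_mul, mul_comm]
  -- The test point has all coordinates `c - s`, with the `i`-th lowered by a further `r`. Large `r`
  -- forces `ν i ≥ 0`; small `s` gives `c * ∑ ν ≤ a`.
  have hval : ∀ s : ℝ, 0 < s → ∀ i, ∀ r : ℝ, 0 ≤ r →
      (c - s) * ∑ j, ν j - r * ν i < a := by
    intro s hs i r hr
    have h := ha (fun j => (c - s) - Pi.single (M := fun _ => ℝ) i r j) (fun j _ => by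
      have : 0 ≤ Pi.single (M := fun _ => ℝ) i r j := by
        by_cases h : j = i
        · subst h; simpa using hr
        · simp [h]
      change (c - s) - Pi.single (M := fun _ => ℝ) i r j < c
      linarith)
    rw [hfν] at h
    simp only [mul_sub, Finset.sum_sub_distrib, ← Finset.sum_mul] at h
    have h2 : ∑ j, ν j * Pi.single (M := fun _ => ℝ) i r j = ν i * r := by
      rw [Finset.sum_eq_single i] <;> simp +contextual
    rw [h2] at h
    linarith
  have hν0 : ∀ i, 0 ≤ ν i := by
    intro i
    by_contra hneg
    push Not at hneg
    set D := (c - 1) * ∑ j, ν j - a with hD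
    have h := hval 1 one_pos i (max 0 (D / ν i)) (le_max_left _ _)
    have h2 : max 0 (D / ν i) * ν i ≤ D := by
      calc _ ≤ D / ν i * ν i := mul_le_mul_of_nonpos_right (le_max_right _ _) hneg.le
        _ = D := div_mul_cancel₀ _ hneg.ne
    linarith
  have hsum0 : 0 ≤ ∑ i, ν i := Finset.sum_nonneg fun i _ => hν0 i
  have hsum : 0 < ∑ i, ν i := by
    refine lt_of_le_of_ne hsum0 fun h => ?_
    obtain ⟨x, hx⟩ := hne
    obtain ⟨i, -⟩ := hc x hx
    have hz : ∀ j, ν j = 0 := fun j =>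
      (Finset.sum_eq_zero_iff_of_nonneg fun i _ => hν0 i).mp h.symm j (Finset.mem_univ j)
    have h1 := hval 1 one_pos i 0 le_rfl
    have h2 := hb x hx
    rw [hfν] at h2
    simp [hz] at h1 h2
    linarith
  have hca : c * ∑ i, ν i ≤ a := by
    obtain ⟨x, hx⟩ := hne
    obtain ⟨i, -⟩ := hc x hx
    by_contra hlt
    push Not at hlt
    have h := hval ((c * ∑ i, ν i - a) / ∑ i, ν i) (div_pos (by linarith) hsum) i 0 le_rfl
    rw [sub_mul, div_mul_cancel₀ _ hsum.ne'] at h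
    linarith
  refine ⟨fun i => ν i / ∑ j, ν j, fun i => div_nonneg (hν0 i) hsum0, ?_, fun x hx => ?_⟩
  · rw [← Finset.sum_div, div_self hsum.ne']
  · have h := hb x hx
    rw [hfν] at h
    simp only [div_mul_eq_mul_div, ← Finset.sum_div]
    rw [le_div_iff₀ hsum]
    linarith

end Duality

/-! ### Eigenvalue programs and semidefinite programs -/

section Programs

variable {N : ℕ} {A₁ A₂ A₃ : Matrix (Fin N) (Fin N) ℂ}

lemma isHermitian_real_smul {A : Matrix (Fin N) (Fin N) ℂ} (hA : A.IsHermitian) (t : ℝ) :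
    (t • A).IsHermitian := by
  simp [Matrix.IsHermitian, hA.eq]

/-- A level is feasible for given `t` exactly when it does not exceed the smallest eigenvalue.
Suprema and maxima thus transfer from one program to the other. -/
lemma coe_lowerClosure_eigValuesTwo (hN : 0 < N) (h₁ : A₁.IsHermitian) (h₂ : A₂.IsHermitian) :
    (lowerClosure (eigValuesTwo A₁ A₂) : Set ℝ) = sdpValuesTwo A₁ A₂ := by
  ext l
  simp only [SetLike.mem_coe, mem_lowerClosure, eigValuesTwo, sdpValuesTwo, Set.mem_ofPred_eq]
  constructor
  · rintro ⟨_, ⟨t, rfl⟩, h⟩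
    exact ⟨t, (posSemidef_sub_smul_one_iff_le_lambdaMin hN
      (h₁.add (isHermitian_real_smul h₂ t))).mpr h⟩
  · rintro ⟨t, h⟩
    exact ⟨_, ⟨t, rfl⟩, (posSemidef_sub_smul_one_iff_le_lambdaMin hN
      (h₁.add (isHermitian_real_smul h₂ t))).mp h⟩

lemma coe_lowerClosure_eigValuesThree (hN : 0 < N) (h₁ : A₁.IsHermitian) (h₂ : A₂.IsHermitian)
    (h₃ : A₃.IsHermitian) :
    (lowerClosure (eigValuesThree A₁ A₂ A₃) : Set ℝ) = sdpValuesThree A₁ A₂ A₃ := by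
  ext l
  simp only [SetLike.mem_coe, mem_lowerClosure, eigValuesThree, sdpValuesThree, Set.mem_ofPred_eq]
  constructor
  · rintro ⟨_, ⟨s, t, rfl⟩, h⟩
    exact ⟨s, t, (posSemidef_sub_smul_one_iff_le_lambdaMin hN
      ((h₁.add (isHermitian_real_smul h₂ s)).add (isHermitian_real_smul h₃ t))).mpr h⟩
  · rintro ⟨s, t, h⟩
    exact ⟨_, ⟨s, t, rfl⟩, (posSemidef_sub_smul_one_iff_le_lambdaMin hN
      ((h₁.add (isHermitian_real_smul h₂ s)).add (isHermitian_real_smul h₃ t))).mp h⟩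

lemma isLUB_lowerClosure {S : Set ℝ} {p : ℝ} (h : IsLUB S p) :
    IsLUB (lowerClosure S : Set ℝ) p := by
  rwa [IsLUB, upperBounds_lowerClosure]

lemma isGreatest_lowerClosure {S : Set ℝ} {p : ℝ} (h : IsGreatest S p) :
    IsGreatest (lowerClosure S : Set ℝ) p :=
  ⟨subset_lowerClosure h.1, by rw [upperBounds_lowerClosure]; exact h.2⟩

lemma isLUB_of_forall_lt_exists_le {S : Set ℝ} {p : ℝ} (hub : ∀ x ∈ S, x ≤ p)
    (h : ∀ l < p, ∃ x ∈ S, l ≤ x) : IsLUB S p :=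
  ⟨hub, fun _ hb => le_of_forall_lt_imp_le_of_dense fun l hl =>
    let ⟨_, hx, hlx⟩ := h l hl
    hlx.trans (hb hx)⟩

lemma isGreatest_of_exists_le {S : Set ℝ} {p : ℝ} (hub : ∀ x ∈ S, x ≤ p)
    (h : ∃ x ∈ S, p ≤ x) : IsGreatest S p := by
  obtain ⟨x, hx, hpx⟩ := h
  exact ⟨by rwa [le_antisymm hpx (hub x hx)], hub⟩

lemma not_bddAbove_of_forall_exists_le {S : Set ℝ} (h : ∀ l, ∃ x ∈ S, l ≤ x) : ¬ BddAbove S := by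
  rintro ⟨b, hb⟩
  obtain ⟨x, hx, hlx⟩ := h (b + 1)
  linarith [hb hx]

lemma le_of_mem_eigValuesTwo (hN : 0 < N) (h₁ : A₁.IsHermitian) (h₂ : A₂.IsHermitian)
    {u : EuclideanSpace ℂ (Fin N)} (hu : u ∈ unitVectors N) (hu₂ : quadVal A₂ u = 0) :
    ∀ x ∈ eigValuesTwo A₁ A₂, x ≤ quadVal A₁ u := by
  rintro _ ⟨t, rfl⟩
  have := (le_lambdaMin_iff hN (h₁.add (isHermitian_real_smul h₂ t))).mp le_rfl u hu
  simpa [quadVal_add, quadVal_matrix_smul, hu₂] using this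

lemma le_of_mem_eigValuesThree (hN : 0 < N) (h₁ : A₁.IsHermitian) (h₂ : A₂.IsHermitian)
    (h₃ : A₃.IsHermitian) {u : EuclideanSpace ℂ (Fin N)} (hu : u ∈ unitVectors N)
    (hu₂ : quadVal A₂ u = 0) (hu₃ : quadVal A₃ u = 0) :
    ∀ x ∈ eigValuesThree A₁ A₂ A₃, x ≤ quadVal A₁ u := by
  rintro _ ⟨s, t, rfl⟩
  have := (le_lambdaMin_iff hN ((h₁.add (isHermitian_real_smul h₂ s)).add
    (isHermitian_real_smul h₃ t))).mp le_rfl u hu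
  simpa [quadVal_add, quadVal_matrix_smul, hu₂, hu₃] using this

lemma exists_mem_eigValuesTwo (hN : 0 < N) (h₁ : A₁.IsHermitian) (h₂ : A₂.IsHermitian) {l t : ℝ}
    (h : ∀ u ∈ unitVectors N, l ≤ quadVal A₁ u + t * quadVal A₂ u) :
    ∃ x ∈ eigValuesTwo A₁ A₂, l ≤ x :=
  ⟨_, ⟨t, rfl⟩, (le_lambdaMin_iff hN (h₁.add (isHermitian_real_smul h₂ t))).mpr fun u hu => by
    rw [quadVal_add, quadVal_matrix_smul]
    exact h u hu⟩

lemma exists_mem_eigValuesThree (hN : 0 < N) (h₁ : A₁.IsHermitian) (h₂ : A₂.IsHermitian)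
    (h₃ : A₃.IsHermitian) {l s t : ℝ}
    (h : ∀ u ∈ unitVectors N, l ≤ quadVal A₁ u + s * quadVal A₂ u + t * quadVal A₃ u) :
    ∃ x ∈ eigValuesThree A₁ A₂ A₃, l ≤ x :=
  ⟨_, ⟨s, t, rfl⟩, (le_lambdaMin_iff hN ((h₁.add (isHermitian_real_smul h₂ s)).add
      (isHermitian_real_smul h₃ t))).mpr fun u hu => by
    rw [quadVal_add, quadVal_add, quadVal_matrix_smul, quadVal_matrix_smul]
    exact h u hu⟩

lemma isHermitian_vec (h₁ : A₁.IsHermitian) (h₂ : A₂.IsHermitian) (h₃ : A₃.IsHermitian) :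
    ∀ i, (![A₁, A₂, A₃] i).IsHermitian := by
  intro i
  fin_cases i <;> assumption

/-- The joint range of two matrices. -/
def pairRange (A₁ A₂ : Matrix (Fin N) (Fin N) ℂ) : Set (ℝ × ℝ) :=
  (fun u => (quadVal A₁ u, quadVal A₂ u)) '' unitVectors N

/-- The joint range of three matrices, with the first coordinate split off. -/
def tripleRange (A₁ A₂ A₃ : Matrix (Fin N) (Fin N) ℂ) : Set (ℝ × (ℝ × ℝ)) :=
  (fun u => (quadVal A₁ u, (quadVal A₂ u, quadVal A₃ u))) '' unitVectors N

lemma isCompact_pairRange (A₁ A₂ : Matrix (Fin N) (Fin N) ℂ) : IsCompact (pairRange A₁ A₂) :=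
  (isCompact_unitVectors N).image ((continuous_quadVal A₁).prodMk (continuous_quadVal A₂))

lemma isCompact_tripleRange (A₁ A₂ A₃ : Matrix (Fin N) (Fin N) ℂ) :
    IsCompact (tripleRange A₁ A₂ A₃) :=
  (isCompact_unitVectors N).image ((continuous_quadVal A₁).prodMk
    ((continuous_quadVal A₂).prodMk (continuous_quadVal A₃)))

lemma convex_tripleRange (hN : 3 ≤ N) (h₁ : A₁.IsHermitian) (h₂ : A₂.IsHermitian)
    (h₃ : A₃.IsHermitian) : Convex ℝ (tripleRange A₁ A₂ A₃) := by
  have h := (convex_jointRange hN (isHermitian_vec h₁ h₂ h₃)).linear_image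
    ((LinearMap.proj 0).prod ((LinearMap.proj 1).prod (LinearMap.proj 2)) :
      (Fin 3 → ℝ) →ₗ[ℝ] ℝ × (ℝ × ℝ))
  rw [jointRange, Set.image_image] at h
  exact h

lemma convex_pairRange (hN : 3 ≤ N) (h₁ : A₁.IsHermitian) (h₂ : A₂.IsHermitian) :
    Convex ℝ (pairRange A₁ A₂) := by
  -- The pair is treated as a triple with the second matrix repeated.
  have h := (convex_jointRange hN (isHermitian_vec h₁ h₂ h₂)).linear_image
    ((LinearMap.proj 0).prod (LinearMap.proj 1) : (Fin 3 → ℝ) →ₗ[ℝ] ℝ × ℝ)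
  rw [jointRange, Set.image_image] at h
  exact h

lemma strongDual_real_apply (g : StrongDual ℝ ℝ) (y : ℝ) : g y = g 1 * y := by
  have := g.map_smul y 1
  simp only [smul_eq_mul, mul_one] at this
  rw [this, mul_comm]

lemma strongDual_real_prod_apply (g : StrongDual ℝ (ℝ × ℝ)) (y z : ℝ) :
    g (y, z) = g (1, 0) * y + g (0, 1) * z := by
  have : (y, z) = y • ((1, 0) : ℝ × ℝ) + z • ((0, 1) : ℝ × ℝ) := by simp
  rw [this, map_add, map_smul, map_smul, smul_eq_mul, smul_eq_mul]
  ring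

lemma exists_mem_eigValuesTwo_of_lt (hN : 3 ≤ N) (h₁ : A₁.IsHermitian) (h₂ : A₂.IsHermitian)
    {l : ℝ} (hl : ∀ u ∈ unitVectors N, quadVal A₂ u = 0 → l < quadVal A₁ u) :
    ∃ x ∈ eigValuesTwo A₁ A₂, l ≤ x := by
  obtain ⟨g, hg⟩ := exists_multiplier_of_lt (convex_pairRange hN h₁ h₂) (isCompact_pairRange _ _)
    (l := l) (by
      rintro x ⟨u, hu, h⟩
      simp only [Prod.mk.injEq] at h
      rw [← h.1]
      exact hl u hu h.2)
  refine exists_mem_eigValuesTwo (t := g 1) (by omega) h₁ h₂ fun u hu => ?_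
  have := hg _ _ ⟨u, hu, rfl⟩
  rwa [strongDual_real_apply] at this

lemma exists_mem_eigValuesThree_of_lt (hN : 3 ≤ N) (h₁ : A₁.IsHermitian) (h₂ : A₂.IsHermitian)
    (h₃ : A₃.IsHermitian) {l : ℝ}
    (hl : ∀ u ∈ unitVectors N, quadVal A₂ u = 0 → quadVal A₃ u = 0 → l < quadVal A₁ u) :
    ∃ x ∈ eigValuesThree A₁ A₂ A₃, l ≤ x := by
  obtain ⟨g, hg⟩ := exists_multiplier_of_lt (convex_tripleRange hN h₁ h₂ h₃)
    (isCompact_tripleRange _ _ _) (l := l) (by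
      rintro x ⟨u, hu, h⟩
      simp only [Prod.mk.injEq, Prod.mk_eq_zero] at h
      rw [← h.1]
      exact hl u hu h.2.1 h.2.2)
  refine exists_mem_eigValuesThree (s := g (1, 0)) (t := g (0, 1)) (by omega) h₁ h₂ h₃
    fun u hu => ?_
  have := hg _ _ ⟨u, hu, rfl⟩
  rwa [strongDual_real_prod_apply, ← add_assoc] at this

lemma exists_mem_eigValuesTwo_of_le (hN : 3 ≤ N) (h₁ : A₁.IsHermitian) (h₂ : A₂.IsHermitian)
    {p : ℝ} (hp : ∀ u ∈ unitVectors N, quadVal A₂ u = 0 → p ≤ quadVal A₁ u)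
    (hpos : ¬ A₂.PosSemidef) (hneg : ¬ (-A₂).PosSemidef) :
    ∃ x ∈ eigValuesTwo A₁ A₂, p ≤ x := by
  rw [posSemidef_iff_quadVal h₂] at hpos
  rw [posSemidef_iff_quadVal h₂.neg] at hneg
  push Not at hpos hneg
  obtain ⟨u₁, hu₁, hv₁⟩ := hpos
  obtain ⟨u₂, hu₂, hv₂⟩ := hneg
  rw [show -A₂ = (-1 : ℝ) • A₂ by simp, quadVal_matrix_smul] at hv₂
  obtain ⟨g, hg⟩ := exists_multiplier_of_le (convex_pairRange hN h₁ h₂) (isCompact_pairRange _ _)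
    ((unitVectors_nonempty (by omega)).image _) (p := p) (by
      rintro x ⟨u, hu, h⟩
      simp only [Prod.mk.injEq] at h
      rw [← h.1]
      exact hp u hu h.2) (by
      intro g hg
      have hg1 : g 1 ≠ 0 := fun h => hg (by ext; simpa using h)
      rcases lt_or_gt_of_ne hg1 with h | h
      · refine ⟨_, ⟨u₂, hu₂, rfl⟩, ?_⟩
        rw [strongDual_real_apply]
        nlinarith
      · refine ⟨_, ⟨u₁, hu₁, rfl⟩, ?_⟩
        rw [strongDual_real_apply]
        nlinarith)
  refine exists_mem_eigValuesTwo (t := g 1) (by omega) h₁ h₂ fun u hu => ?_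
  have := hg _ _ ⟨u, hu, rfl⟩
  rwa [strongDual_real_apply] at this

lemma exists_mem_eigValuesThree_of_le (hN : 3 ≤ N) (h₁ : A₁.IsHermitian) (h₂ : A₂.IsHermitian)
    (h₃ : A₃.IsHermitian) {p : ℝ}
    (hp : ∀ u ∈ unitVectors N, quadVal A₂ u = 0 → quadVal A₃ u = 0 → p ≤ quadVal A₁ u)
    (hind : ∀ s t : ℝ, (s ≠ 0 ∨ t ≠ 0) → ¬ (s • A₂ + t • A₃).PosSemidef) :
    ∃ x ∈ eigValuesThree A₁ A₂ A₃, p ≤ x := by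
  obtain ⟨g, hg⟩ := exists_multiplier_of_le (convex_tripleRange hN h₁ h₂ h₃)
    (isCompact_tripleRange _ _ _) ((unitVectors_nonempty (by omega)).image _) (p := p) (by
      rintro x ⟨u, hu, h⟩
      simp only [Prod.mk.injEq, Prod.mk_eq_zero] at h
      rw [← h.1]
      exact hp u hu h.2.1 h.2.2) (by
      intro g hg
      have hne : g (1, 0) ≠ 0 ∨ g (0, 1) ≠ 0 := by
        by_contra h
        push Not at h
        apply hg
        ext
        · simpa using h.1
        · simpa using h.2
      have h := hind _ _ hne
      rw [posSemidef_iff_quadVal ((isHermitian_real_smul h₂ _).add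
        (isHermitian_real_smul h₃ _))] at h
      push Not at h
      obtain ⟨u, hu, h⟩ := h
      rw [quadVal_add, quadVal_matrix_smul, quadVal_matrix_smul] at h
      refine ⟨_, ⟨u, hu, rfl⟩, ?_⟩
      rwa [strongDual_real_prod_apply])
  refine exists_mem_eigValuesThree (s := g (1, 0)) (t := g (0, 1)) (by omega) h₁ h₂ h₃
    fun u hu => ?_
  have := hg _ _ ⟨u, hu, rfl⟩
  rwa [strongDual_real_prod_apply, ← add_assoc] at this

end Programs

/-! ### Optima of the min-max problem and candidate points -/

section MinMax

variable {N : ℕ} {C : Fin 3 → Matrix (Fin N) (Fin N) ℂ}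

lemma maxCost_le_iff {u : EuclideanSpace ℂ (Fin N)} {b : ℝ} :
    maxCost C u ≤ b ↔ ∀ i, quadVal (C i) u ≤ b := by
  simp [maxCost, Fin.forall_fin_succ]

lemma quadVal_le_maxCost (u : EuclideanSpace ℂ (Fin N)) (i : Fin 3) :
    quadVal (C i) u ≤ maxCost C u :=
  maxCost_le_iff.mp le_rfl i

lemma activeSet_nonempty (C : Fin 3 → Matrix (Fin N) (Fin N) ℂ)
    (u : EuclideanSpace ℂ (Fin N)) : (activeSet C u).Nonempty := by
  by_contra h
  rw [Set.not_nonempty_iff_eq_empty] at h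
  have hlt : ∀ i, quadVal (C i) u < maxCost C u := fun i =>
    lt_of_le_of_ne (quadVal_le_maxCost u i) fun hi => by
      have : i ∈ activeSet C u := hi
      rw [h] at this
      exact this
  have : maxCost C u < maxCost C u := max_lt (hlt 0) (max_lt (hlt 1) (hlt 2))
  exact lt_irrefl _ this

lemma mem_bindingSet_activeSet {u : EuclideanSpace ℂ (Fin N)} (hu : u ∈ unitVectors N) :
    u ∈ bindingSet C (activeSet C u) :=
  ⟨hu, fun _ hi _ hj => Eq.trans hi (Eq.symm hj)⟩

lemma continuous_maxCost (C : Fin 3 → Matrix (Fin N) (Fin N) ℂ) : Continuous (maxCost C) :=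
  (continuous_quadVal _).max ((continuous_quadVal _).max (continuous_quadVal _))

lemma exists_isLeast_maxCost (hN : 0 < N) (C : Fin 3 → Matrix (Fin N) (Fin N) ℂ) :
    ∃ c, IsLeast (maxCost C '' unitVectors N) c := by
  obtain ⟨u, hu, hmin⟩ := (isCompact_unitVectors N).exists_isMinOn (unitVectors_nonempty hN)
    (continuous_maxCost C).continuousOn
  exact ⟨_, ⟨u, hu, rfl⟩, by rintro _ ⟨v, hv, rfl⟩; exact hmin hv⟩

lemma isCompact_bindingSet (C : Fin 3 → Matrix (Fin N) (Fin N) ℂ) (I : Set (Fin 3)) :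
    IsCompact (bindingSet C I) := by
  have : bindingSet C I = unitVectors N ∩
      ⋂ i ∈ I, ⋂ j ∈ I, {u | quadVal (C i) u = quadVal (C j) u} := by
    ext u
    simp [bindingSet]
  rw [this]
  exact (isCompact_unitVectors N).inter_right <| isClosed_biInter fun i _ =>
    isClosed_biInter fun j _ => isClosed_eq (continuous_quadVal _) (continuous_quadVal _)

lemma exists_isCandidate {I : Set (Fin 3)} (hI : I.Nonempty) (hne : (bindingSet C I).Nonempty) :
    ∃ u, IsCandidate C I u := by
  obtain ⟨i, hi⟩ := hI
  obtain ⟨u, hu, hmin⟩ := (isCompact_bindingSet C I).exists_isMinOn hne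
    (continuous_quadVal (C i)).continuousOn
  refine ⟨u, hu, fun j hj v hv => ?_⟩
  rw [hu.2 j hj i hi, hv.2 j hj i hi]
  exact hmin hv

lemma isCandidate_singleton_iff (hN : 0 < N) (hC : ∀ i, (C i).IsHermitian) (i : Fin 3)
    (x : EuclideanSpace ℂ (Fin N)) :
    IsCandidate C {i} x ↔ x ∈ unitVectors N ∧ quadVal (C i) x = lambdaMin (C i) := by
  obtain ⟨⟨u, hu, hul⟩, hl⟩ := isLeast_lambdaMin hN (hC i)
  constructor
  · intro h
    refine ⟨h.1.1, le_antisymm ?_ (hl ⟨x, h.1.1, rfl⟩)⟩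
    rw [← hul]
    exact h.2 i rfl u ⟨hu, by rintro _ rfl _ rfl; rfl⟩
  · rintro ⟨hx, hxl⟩
    refine ⟨⟨hx, by rintro _ rfl _ rfl; rfl⟩, ?_⟩
    rintro _ rfl v hv
    rw [hxl]
    exact hl ⟨v, hv.1, rfl⟩

lemma isCandidate_singleton_iff_eigenvector (hN : 0 < N) (hC : ∀ i, (C i).IsHermitian) (i : Fin 3)
    (x : EuclideanSpace ℂ (Fin N)) :
    IsCandidate C {i} x ↔
      ‖x‖ = 1 ∧ (C i).mulVec x.ofLp = (lambdaMin (C i) : ℂ) • x.ofLp := by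
  rw [isCandidate_singleton_iff hN hC]
  constructor
  · rintro ⟨hx, hxl⟩
    refine ⟨hx, ?_⟩
    rw [← hxl]
    refine eigenvector_of_isMin (hC i) (fun v hv => ?_) hx
    rw [hxl]
    exact (isLeast_lambdaMin hN (hC i)).2 ⟨v, hv, rfl⟩
  · rintro ⟨hx, h⟩
    exact ⟨hx, quadVal_of_eigenvector hx h⟩

/-- By convexity, the values on the segment between two points of the joint range are taken. -/
lemma exists_unit_segment (hN : 3 ≤ N) (hC : ∀ i, (C i).IsHermitian)
    {u v : EuclideanSpace ℂ (Fin N)} (hu : u ∈ unitVectors N) (hv : v ∈ unitVectors N) {s : ℝ}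
    (hs0 : 0 ≤ s) (hs1 : s ≤ 1) :
    ∃ w ∈ unitVectors N, ∀ i,
      quadVal (C i) w = quadVal (C i) u + s * (quadVal (C i) v - quadVal (C i) u) := by
  obtain ⟨w, hw, h⟩ := convex_jointRange hN hC ⟨u, hu, rfl⟩ ⟨v, hv, rfl⟩
    (sub_nonneg.mpr hs1) hs0 (sub_add_cancel 1 s)
  refine ⟨w, hw, fun i => ?_⟩
  have := congrFun h i
  simp only [Pi.add_apply, Pi.smul_apply, smul_eq_mul] at this
  rw [this]; ring

variable {c : ℝ}

lemma exists_le_quadVal (hc : IsLeast (maxCost C '' unitVectors N) c)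
    {u : EuclideanSpace ℂ (Fin N)} (hu : u ∈ unitVectors N) : ∃ i, c ≤ quadVal (C i) u := by
  obtain ⟨i, hi⟩ := activeSet_nonempty C u
  exact ⟨i, (hc.2 ⟨u, hu, rfl⟩).trans_eq (Eq.symm hi)⟩

/-- An optimum is a candidate for its own active set. -/
lemma isCandidate_activeSet (hN : 3 ≤ N) (hC : ∀ i, (C i).IsHermitian)
    (hc : IsLeast (maxCost C '' unitVectors N) c) {u : EuclideanSpace ℂ (Fin N)}
    (hu : u ∈ unitVectors N) (huc : maxCost C u = c) : IsCandidate C (activeSet C u) u := by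
  refine ⟨mem_bindingSet_activeSet hu, fun i hi v hv => ?_⟩
  by_contra hlt
  push Not at hlt
  have hic : quadVal (C i) u = maxCost C u := hi
  -- A short step along the segment from `u` towards the better point `v` lowers the binding values
  -- and keeps the others below `c`; convexity realizes it by a unit vector.
  have hsmall : ∀ᶠ s in nhdsWithin (0 : ℝ) (Set.Ioi 0), ∀ k,
      quadVal (C k) u + s * (quadVal (C k) v - quadVal (C k) u) < c := by
    rw [Filter.eventually_all]
    intro k
    by_cases hk : k ∈ activeSet C u
    · have hkc : quadVal (C k) u = maxCost C u := hk
      have hkv : quadVal (C k) v = quadVal (C i) v := hv.2 k hk i hi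
      filter_upwards [self_mem_nhdsWithin] with s hs
      have hs' : 0 < s := hs
      rw [hkv, hkc, huc]
      rw [hic, huc] at hlt
      nlinarith
    · have hkc : quadVal (C k) u < c := by
        rw [← huc]
        exact lt_of_le_of_ne (quadVal_le_maxCost u k) hk
      have hcont : Filter.Tendsto
          (fun s : ℝ => quadVal (C k) u + s * (quadVal (C k) v - quadVal (C k) u))
          (nhdsWithin 0 (Set.Ioi 0)) (nhds (quadVal (C k) u)) := by
        have : Continuous
            (fun s : ℝ => quadVal (C k) u + s * (quadVal (C k) v - quadVal (C k) u)) := by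
          fun_prop
        have h0 := this.tendsto 0
        rw [zero_mul, add_zero] at h0
        exact h0.mono_left nhdsWithin_le_nhds
      exact hcont.eventually_lt_const hkc
  have hle : ∀ᶠ s in nhdsWithin (0 : ℝ) (Set.Ioi 0), s ∈ Set.Ioo (0 : ℝ) 1 :=
    Ioo_mem_nhdsGT one_pos
  obtain ⟨s, hs, hs01⟩ := (hsmall.and hle).exists
  obtain ⟨w, hw, hwv⟩ := exists_unit_segment hN hC hu hv.1 hs01.1.le hs01.2.le
  obtain ⟨k, hk⟩ := exists_le_quadVal hc hw
  rw [hwv] at hk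
  exact absurd (hs k) (not_lt.mpr hk)

/-- If the active set of an optimum `u` is as large as possible, every candidate for this set is
an optimum. -/
lemma maxCost_eq_of_maximal_activeSet (hN : 3 ≤ N) (hC : ∀ i, (C i).IsHermitian)
    (hc : IsLeast (maxCost C '' unitVectors N) c) {u w : EuclideanSpace ℂ (Fin N)}
    (hu : u ∈ unitVectors N) (huc : maxCost C u = c)
    (hmax : ∀ v ∈ unitVectors N, maxCost C v = c → activeSet C u ⊆ activeSet C v →
      activeSet C v ⊆ activeSet C u)
    (hw : IsCandidate C (activeSet C u) w) : maxCost C w = c := by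
  refine le_antisymm ?_ (hc.2 ⟨w, hw.1.1, rfl⟩)
  have hcu := isCandidate_activeSet hN hC hc hu huc
  have hact : ∀ i ∈ activeSet C u, quadVal (C i) w = c := fun i hi => by
    have hic : quadVal (C i) u = maxCost C u := hi
    rw [← huc, ← hic]
    exact le_antisymm (hw.2 i hi u hcu.1) (hcu.2 i hi w hw.1)
  by_contra hbig
  rw [maxCost_le_iff] at hbig
  push Not at hbig
  obtain ⟨k₀, hk₀⟩ := hbig
  have hxle : ∀ i, quadVal (C i) u ≤ c := fun i => huc ▸ quadVal_le_maxCost u i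
  -- On the segment from `u` to `w` the values binding at `u` stay equal to `c`. The index `k` is
  -- the first to reach `c`, so the point there is still optimal but has `k` binding as well,
  -- against maximality.
  obtain ⟨k, hkF, hkmin⟩ := (Finset.univ.filter fun k => c < quadVal (C k) w).exists_min_image
    (fun k => (c - quadVal (C k) u) / (quadVal (C k) w - quadVal (C k) u))
    ⟨k₀, by simpa using hk₀⟩
  have hk : c < quadVal (C k) w := by simpa using hkF
  set s := (c - quadVal (C k) u) / (quadVal (C k) w - quadVal (C k) u) with hs
  have hden : ∀ j, c < quadVal (C j) w → 0 < quadVal (C j) w - quadVal (C j) u := fun j hj => by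
    linarith [hxle j]
  have hs0 : 0 ≤ s := div_nonneg (by linarith [hxle k]) (hden k hk).le
  have hs1 : s ≤ 1 := by
    rw [hs, div_le_one (hden k hk)]
    linarith
  obtain ⟨v, hv, hvv⟩ := exists_unit_segment hN hC hu hw.1.1 hs0 hs1
  have hvle : ∀ j, quadVal (C j) v ≤ c := by
    intro j
    rw [hvv]
    by_cases hj : c < quadVal (C j) w
    · have h1 := hkmin j (by simpa using hj)
      rw [le_div_iff₀ (hden j hj)] at h1
      linarith
    · push Not at hj
      nlinarith [hxle j]
  have hvc : maxCost C v = c := le_antisymm (maxCost_le_iff.mpr hvle) (hc.2 ⟨v, hv, rfl⟩)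
  have hsub : activeSet C u ⊆ activeSet C v := fun i hi => by
    have hic : quadVal (C i) u = maxCost C u := hi
    change quadVal (C i) v = maxCost C v
    rw [hvv, hact i hi, hic, huc, hvc]
    ring
  have hkv : k ∈ activeSet C v := by
    change quadVal (C k) v = maxCost C v
    rw [hvv, hvc, hs, div_mul_cancel₀ _ (hden k hk).ne']
    ring
  exact hk.ne' (hact k (hmax v hv hvc hsub hkv))

lemma exists_maximal_activeSet (hc : IsLeast (maxCost C '' unitVectors N) c) :
    ∃ u ∈ unitVectors N, maxCost C u = c ∧
      ∀ v ∈ unitVectors N, maxCost C v = c → activeSet C u ⊆ activeSet C v →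
        activeSet C v ⊆ activeSet C u := by
  obtain ⟨u₀, hu₀, huc₀⟩ := hc.1
  obtain ⟨I, hI⟩ := (Set.toFinite {I | ∃ u ∈ unitVectors N, maxCost C u = c ∧
    activeSet C u = I}).exists_maximal ⟨_, u₀, hu₀, huc₀, rfl⟩
  obtain ⟨u, hu, huc, rfl⟩ := hI.prop
  exact ⟨u, hu, huc, fun v hv hvc h => hI.le_of_ge ⟨v, hv, hvc, rfl⟩ h⟩

/-- Multipliers at an optimum, supported on the active set. -/
lemma exists_multipliers (hN : 3 ≤ N) (hC : ∀ i, (C i).IsHermitian)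
    (hc : IsLeast (maxCost C '' unitVectors N) c) {u : EuclideanSpace ℂ (Fin N)}
    (hu : u ∈ unitVectors N) (huc : maxCost C u = c) :
    ∃ μ : Fin 3 → ℝ, ∑ i, μ i = 1 ∧ (∀ i ∉ activeSet C u, μ i = 0) ∧
      ∀ v ∈ unitVectors N, c ≤ ∑ i, μ i * quadVal (C i) v := by
  obtain ⟨μ, hμ0, hμ1, hμ⟩ := exists_weights_of_le_max (convex_jointRange hN hC) (c := c)
    (by rintro _ ⟨v, hv, rfl⟩; exact exists_le_quadVal hc hv) ⟨_, u, hu, rfl⟩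
  refine ⟨μ, hμ1, fun i hi => ?_, fun v hv => hμ _ ⟨v, hv, rfl⟩⟩
  have hnn : ∀ j ∈ Finset.univ, 0 ≤ μ j * (c - quadVal (C j) u) := fun j _ =>
    mul_nonneg (hμ0 j) (by linarith [quadVal_le_maxCost (C := C) u j])
  -- Complementary slackness: the terms are nonnegative, and the weighted mean at `u` is at least
  -- `c`.
  have hsum : ∑ j, μ j * (c - quadVal (C j) u) = 0 := by
    refine le_antisymm ?_ (Finset.sum_nonneg hnn)
    simp only [mul_sub, Finset.sum_sub_distrib, ← Finset.sum_mul, hμ1]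
    linarith [hμ _ ⟨u, hu, rfl⟩]
  have h := (Finset.sum_eq_zero_iff_of_nonneg hnn).mp hsum i (Finset.mem_univ i)
  refine (mul_eq_zero.mp h).resolve_right fun h0 => hi ?_
  change quadVal (C i) u = maxCost C u
  linarith

end MinMax

/-! ### Three, two or one binding constraints -/

section Binding

variable {N : ℕ} {C : Fin 3 → Matrix (Fin N) (Fin N) ℂ}

lemma mem_bindingSet_univ_iff {u : EuclideanSpace ℂ (Fin N)} :
    u ∈ bindingSet C Set.univ ↔
      u ∈ unitVectors N ∧ quadVal (C 0 - C 1) u = 0 ∧ quadVal (C 0 - C 2) u = 0 := by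
  simp only [bindingSet, Set.mem_ofPred_eq, quadVal_sub, sub_eq_zero]
  refine and_congr_right fun _ => ⟨fun h => ⟨h 0 trivial 1 trivial, h 0 trivial 2 trivial⟩, ?_⟩
  rintro ⟨h1, h2⟩
  have : ∀ i, quadVal (C i) u = quadVal (C 0) u := by
    simp [Fin.forall_fin_succ, h1.symm, h2.symm]
  exact fun i _ j _ => (this i).trans (this j).symm

lemma mem_bindingSet_pair_iff {i j : Fin 3} {u : EuclideanSpace ℂ (Fin N)} :
    u ∈ bindingSet C {i, j} ↔ u ∈ unitVectors N ∧ quadVal (C i - C j) u = 0 := by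
  simp only [bindingSet, Set.mem_ofPred_eq, quadVal_sub, sub_eq_zero]
  refine and_congr_right fun _ => ⟨fun h => h i (by simp) j (by simp), fun h => ?_⟩
  rintro k (rfl | rfl) l (rfl | rfl) <;> simp [h]

variable (hN : 3 ≤ N) (hC : ∀ i, (C i).IsHermitian)

include hN hC

/-- Weak duality holds because the multiplier terms vanish at `z`; strong duality comes from
separation at every level below the value at `z`, and attainment from separation at that value
itself. -/
theorem three_binding {z : EuclideanSpace ℂ (Fin N)} (hz : IsCandidate C Set.univ z) :
    IsLUB (eigValuesThree (C 0) (C 0 - C 1) (C 0 - C 2)) (quadVal (C 0) z) ∧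
    IsLUB (sdpValuesThree (C 0) (C 0 - C 1) (C 0 - C 2)) (quadVal (C 0) z) ∧
    ((∀ s t : ℝ, (s ≠ 0 ∨ t ≠ 0) →
        ¬ (s • (C 0 - C 1) + t • (C 0 - C 2)).PosSemidef) →
      IsGreatest (eigValuesThree (C 0) (C 0 - C 1) (C 0 - C 2)) (quadVal (C 0) z) ∧
      IsGreatest (sdpValuesThree (C 0) (C 0 - C 1) (C 0 - C 2)) (quadVal (C 0) z)) := by
  have h₂ := (hC 0).sub (hC 1)
  have h₃ := (hC 0).sub (hC 2)
  obtain ⟨hz0, hz2, hz3⟩ := mem_bindingSet_univ_iff.mp hz.1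
  have hub := le_of_mem_eigValuesThree (by omega) (hC 0) h₂ h₃ hz0 hz2 hz3
  have hmin : ∀ u ∈ unitVectors N, quadVal (C 0 - C 1) u = 0 → quadVal (C 0 - C 2) u = 0 →
      quadVal (C 0) z ≤ quadVal (C 0) u := fun u hu hu2 hu3 =>
    hz.2 0 trivial u (mem_bindingSet_univ_iff.mpr ⟨hu, hu2, hu3⟩)
  rw [← coe_lowerClosure_eigValuesThree (by omega) (hC 0) h₂ h₃]
  have hlub := isLUB_of_forall_lt_exists_le hub fun l hl =>
    exists_mem_eigValuesThree_of_lt hN (hC 0) h₂ h₃ fun u hu hu2 hu3 =>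
      hl.trans_le (hmin u hu hu2 hu3)
  refine ⟨hlub, isLUB_lowerClosure hlub, fun hind => ?_⟩
  have hgr := isGreatest_of_exists_le hub
    (exists_mem_eigValuesThree_of_le hN (hC 0) h₂ h₃ hmin hind)
  exact ⟨hgr, isGreatest_lowerClosure hgr⟩

theorem three_binding_infeasible (h : bindingSet C Set.univ = ∅) :
    ¬ BddAbove (eigValuesThree (C 0) (C 0 - C 1) (C 0 - C 2)) ∧
    ¬ BddAbove (sdpValuesThree (C 0) (C 0 - C 1) (C 0 - C 2)) := by
  have h₂ := (hC 0).sub (hC 1)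
  have h₃ := (hC 0).sub (hC 2)
  rw [← coe_lowerClosure_eigValuesThree (by omega) (hC 0) h₂ h₃, bddAbove_lowerClosure, and_self]
  refine not_bddAbove_of_forall_exists_le fun l =>
    exists_mem_eigValuesThree_of_lt hN (hC 0) h₂ h₃ fun u hu hu2 hu3 => ?_
  have : u ∈ bindingSet C Set.univ := mem_bindingSet_univ_iff.mpr ⟨hu, hu2, hu3⟩
  rw [h] at this
  exact this.elim

theorem two_binding {i j : Fin 3} {y : EuclideanSpace ℂ (Fin N)} (hy : IsCandidate C {i, j} y) :
    IsLUB (eigValuesTwo (C i) (C i - C j)) (quadVal (C i) y) ∧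
    IsLUB (sdpValuesTwo (C i) (C i - C j)) (quadVal (C i) y) ∧
    (¬ (C i - C j).PosSemidef → ¬ (C j - C i).PosSemidef →
      IsGreatest (eigValuesTwo (C i) (C i - C j)) (quadVal (C i) y) ∧
      IsGreatest (sdpValuesTwo (C i) (C i - C j)) (quadVal (C i) y)) := by
  have h₂ := (hC i).sub (hC j)
  obtain ⟨hy0, hy2⟩ := mem_bindingSet_pair_iff.mp hy.1
  have hub := le_of_mem_eigValuesTwo (by omega) (hC i) h₂ hy0 hy2
  have hmin : ∀ u ∈ unitVectors N, quadVal (C i - C j) u = 0 →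
      quadVal (C i) y ≤ quadVal (C i) u := fun u hu hu2 =>
    hy.2 i (by simp) u (mem_bindingSet_pair_iff.mpr ⟨hu, hu2⟩)
  rw [← coe_lowerClosure_eigValuesTwo (by omega) (hC i) h₂]
  have hlub := isLUB_of_forall_lt_exists_le hub fun l hl =>
    exists_mem_eigValuesTwo_of_lt hN (hC i) h₂ fun u hu hu2 => hl.trans_le (hmin u hu hu2)
  refine ⟨hlub, isLUB_lowerClosure hlub, fun hpos hneg => ?_⟩
  have hgr := isGreatest_of_exists_le hub
    (exists_mem_eigValuesTwo_of_le hN (hC i) h₂ hmin hpos (by rwa [neg_sub]))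
  exact ⟨hgr, isGreatest_lowerClosure hgr⟩

theorem two_binding_infeasible {i j : Fin 3} (h : bindingSet C {i, j} = ∅) :
    ¬ BddAbove (eigValuesTwo (C i) (C i - C j)) ∧
    ¬ BddAbove (sdpValuesTwo (C i) (C i - C j)) := by
  have h₂ := (hC i).sub (hC j)
  rw [← coe_lowerClosure_eigValuesTwo (by omega) (hC i) h₂, bddAbove_lowerClosure, and_self]
  refine not_bddAbove_of_forall_exists_le fun l =>
    exists_mem_eigValuesTwo_of_lt hN (hC i) h₂ fun u hu hu2 => ?_
  have : u ∈ bindingSet C {i, j} := mem_bindingSet_pair_iff.mpr ⟨hu, hu2⟩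
  rw [h] at this
  exact this.elim

variable {c : ℝ} (hc : IsLeast (maxCost C '' unitVectors N) c) {u : EuclideanSpace ℂ (Fin N)}
  (hu : u ∈ unitVectors N) (huc : maxCost C u = c)

include hc hu huc

theorem isGreatest_of_activeSet_eq_univ (hact : activeSet C u = Set.univ) :
    IsGreatest (eigValuesThree (C 0) (C 0 - C 1) (C 0 - C 2)) c ∧
    IsGreatest (sdpValuesThree (C 0) (C 0 - C 1) (C 0 - C 2)) c := by
  have h₂ := (hC 0).sub (hC 1)
  have h₃ := (hC 0).sub (hC 2)
  have hb := mem_bindingSet_activeSet (C := C) hu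
  rw [hact] at hb
  obtain ⟨-, hu2, hu3⟩ := mem_bindingSet_univ_iff.mp hb
  have h0 : quadVal (C 0) u = c := by
    rw [← huc]
    change (0 : Fin 3) ∈ activeSet C u
    rw [hact]; trivial
  have hub := le_of_mem_eigValuesThree (by omega) (hC 0) h₂ h₃ hu hu2 hu3
  rw [h0] at hub
  obtain ⟨μ, hμ1, -, hμ⟩ := exists_multipliers hN hC hc hu huc
  -- As the weights sum to one, `∑ μᵢ cᵢ = c₁ - μ 1 (c₁ - c₂) - μ 2 (c₁ - c₃)`, where `μ` is indexed
  -- from `0`. The weights are therefore dual optimal, with no definiteness condition.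
  have hgr := isGreatest_of_exists_le hub (exists_mem_eigValuesThree (s := -μ 1) (t := -μ 2)
    (by omega) (hC 0) h₂ h₃ fun v hv => by
      have h := hμ v hv
      rw [Fin.sum_univ_three] at h hμ1
      rw [quadVal_sub, quadVal_sub]
      have h4 : μ 0 = 1 - μ 1 - μ 2 := by linarith
      rw [h4] at h
      linarith)
  rw [← coe_lowerClosure_eigValuesThree (by omega) (hC 0) h₂ h₃]
  exact ⟨hgr, isGreatest_lowerClosure hgr⟩

theorem isGreatest_of_activeSet_eq_pair {i j : Fin 3} (hij : i ≠ j)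
    (hact : activeSet C u = {i, j}) :
    IsGreatest (eigValuesTwo (C i) (C i - C j)) c ∧
    IsGreatest (sdpValuesTwo (C i) (C i - C j)) c := by
  have h₂ := (hC i).sub (hC j)
  have hb := mem_bindingSet_activeSet (C := C) hu
  rw [hact] at hb
  obtain ⟨-, hu2⟩ := mem_bindingSet_pair_iff.mp hb
  have h0 : quadVal (C i) u = c := by
    rw [← huc]
    change i ∈ activeSet C u
    rw [hact]; simp
  have hub := le_of_mem_eigValuesTwo (by omega) (hC i) h₂ hu hu2
  rw [h0] at hub
  obtain ⟨μ, hμ1, hμ0, hμ⟩ := exists_multipliers hN hC hc hu huc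
  -- The weight of the nonbinding index vanishes, so one multiplier `-μ j` suffices.
  have hsum : ∀ f : Fin 3 → ℝ, ∑ k, μ k * f k = μ i * f i + μ j * f j := fun f => by
    rw [← Finset.sum_pair hij (f := fun k => μ k * f k)]
    refine (Finset.sum_subset (Finset.subset_univ _) fun k _ hk => ?_).symm
    rw [hμ0 k (by rw [hact]; simpa using hk), zero_mul]
  have hgr := isGreatest_of_exists_le hub (exists_mem_eigValuesTwo (t := -μ j)
    (by omega) (hC i) h₂ fun v hv => by
      have h := hμ v hv
      have h1 := hsum fun _ => 1
      simp only [mul_one, hμ1] at h1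
      rw [hsum] at h
      rw [quadVal_sub]
      have h4 : μ i = 1 - μ j := by linarith
      rw [h4] at h
      linarith)
  rw [← coe_lowerClosure_eigValuesTwo (by omega) (hC i) h₂]
  exact ⟨hgr, isGreatest_lowerClosure hgr⟩

theorem eq_lambdaMin_of_activeSet_eq_singleton {i : Fin 3} (hact : activeSet C u = {i}) :
    c = lambdaMin (C i) := by
  have h := isCandidate_activeSet hN hC hc hu huc
  have h0 : quadVal (C i) u = c := by
    rw [← huc]
    change i ∈ activeSet C u
    rw [hact]; simp
  rw [hact, isCandidate_singleton_iff (by omega) hC] at h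
  exact h0.symm.trans h.2

end Binding

/-! ### The main theorem -/

theorem mainTheorem4 (N : ℕ) (hN : 3 ≤ N) (C : Fin 3 → Matrix (Fin N) (Fin N) ℂ)
    (hC : ∀ i, (C i).IsHermitian) :
    ∃ cstar : ℝ,
      -- the minimum `cstar` of the min-max problem is attained
      IsLeast (maxCost C '' unitVectors N) cstar ∧
      -- a candidate point exists for every `I` whose binding condition can be met
      (∀ I : Set (Fin 3), I.Nonempty → (bindingSet C I).Nonempty → ∃ u, IsCandidate C I u) ∧
      -- `cstar` is the best value of the objective at the (at most seven) candidate points,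
      -- however these are chosen
      (∀ w : Set (Fin 3) → EuclideanSpace ℂ (Fin N),
        (∀ I : Set (Fin 3), I.Nonempty → (bindingSet C I).Nonempty → IsCandidate C I (w I)) →
        IsLeast {r : ℝ | ∃ I : Set (Fin 3), I.Nonempty ∧ (bindingSet C I).Nonempty ∧
          r = maxCost C (w I)} cstar) ∧
      -- three binding constraints
      (∀ z, IsCandidate C Set.univ z →
        IsLUB (eigValuesThree (C 0) (C 0 - C 1) (C 0 - C 2)) (quadVal (C 0) z) ∧
        IsLUB (sdpValuesThree (C 0) (C 0 - C 1) (C 0 - C 2)) (quadVal (C 0) z) ∧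
        ((∀ s t : ℝ, (s ≠ 0 ∨ t ≠ 0) →
            ¬ (s • (C 0 - C 1) + t • (C 0 - C 2)).PosSemidef) →
          IsGreatest (eigValuesThree (C 0) (C 0 - C 1) (C 0 - C 2)) (quadVal (C 0) z) ∧
          IsGreatest (sdpValuesThree (C 0) (C 0 - C 1) (C 0 - C 2)) (quadVal (C 0) z))) ∧
      (bindingSet C Set.univ = ∅ →
        ¬ BddAbove (eigValuesThree (C 0) (C 0 - C 1) (C 0 - C 2)) ∧
        ¬ BddAbove (sdpValuesThree (C 0) (C 0 - C 1) (C 0 - C 2))) ∧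
      -- two binding constraints
      (∀ i j : Fin 3, i ≠ j →
        (∀ y, IsCandidate C {i, j} y →
          IsLUB (eigValuesTwo (C i) (C i - C j)) (quadVal (C i) y) ∧
          IsLUB (sdpValuesTwo (C i) (C i - C j)) (quadVal (C i) y) ∧
          (¬ (C i - C j).PosSemidef → ¬ (C j - C i).PosSemidef →
            IsGreatest (eigValuesTwo (C i) (C i - C j)) (quadVal (C i) y) ∧
            IsGreatest (sdpValuesTwo (C i) (C i - C j)) (quadVal (C i) y))) ∧
        (bindingSet C {i, j} = ∅ →
          ¬ BddAbove (eigValuesTwo (C i) (C i - C j)) ∧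
          ¬ BddAbove (sdpValuesTwo (C i) (C i - C j)))) ∧
      -- a single binding constraint: the candidates are the unit eigenvectors for `λ_min (C i)`
      (∀ (i : Fin 3) (x : EuclideanSpace ℂ (Fin N)),
        (IsCandidate C {i} x ↔
          ‖x‖ = 1 ∧ (C i).mulVec x.ofLp = (lambdaMin (C i) : ℂ) • x.ofLp) ∧
        (IsCandidate C {i} x → quadVal (C i) x = lambdaMin (C i))) ∧
      -- the three cases at an arbitrary optimum `u`
      (∀ u ∈ unitVectors N, maxCost C u = cstar →
        IsCandidate C (activeSet C u) u ∧
        (activeSet C u = Set.univ →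
          IsGreatest (eigValuesThree (C 0) (C 0 - C 1) (C 0 - C 2)) cstar ∧
          IsGreatest (sdpValuesThree (C 0) (C 0 - C 1) (C 0 - C 2)) cstar) ∧
        (∀ i j : Fin 3, i ≠ j → activeSet C u = {i, j} →
          IsGreatest (eigValuesTwo (C i) (C i - C j)) cstar ∧
          IsGreatest (sdpValuesTwo (C i) (C i - C j)) cstar) ∧
        (∀ i : Fin 3, activeSet C u = {i} → cstar = lambdaMin (C i))) := by
  have hN0 : 0 < N := by omega
  obtain ⟨c, hc⟩ := exists_isLeast_maxCost hN0 C
  refine ⟨c, hc, fun I => exists_isCandidate, fun w hw => ⟨?_, ?_⟩,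
    fun z => three_binding hN hC, three_binding_infeasible hN hC,
    fun i j _ => ⟨fun y => two_binding hN hC, two_binding_infeasible hN hC⟩,
    fun i x => ⟨isCandidate_singleton_iff_eigenvector hN0 hC i x,
      fun h => ((isCandidate_singleton_iff hN0 hC i x).mp h).2⟩,
    fun u hu huc => ⟨isCandidate_activeSet hN hC hc hu huc,
      isGreatest_of_activeSet_eq_univ hN hC hc hu huc,
      fun i j => isGreatest_of_activeSet_eq_pair hN hC hc hu huc,
      fun i => eq_lambdaMin_of_activeSet_eq_singleton hN hC hc hu huc⟩⟩
  -- An arbitrary optimum would not do: a chosen candidate for its binding set may violate a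
  -- nonbinding constraint. Maximality of the binding set excludes this.
  · obtain ⟨u, hu, huc, hmax⟩ := exists_maximal_activeSet hc
    have hne := activeSet_nonempty C u
    have hb : (bindingSet C (activeSet C u)).Nonempty := ⟨u, mem_bindingSet_activeSet hu⟩
    exact ⟨_, hne, hb,
      (maxCost_eq_of_maximal_activeSet hN hC hc hu huc hmax (hw _ hne hb)).symm⟩
  · rintro _ ⟨I, hI, hb, rfl⟩
    exact hc.2 ⟨_, (hw I hI hb).1.1, rfl⟩
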